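/- All functions are real-valued, $2\pi$-periodic and Lebesgue measurable, with $\|f\|_p=\big(\int_0^{2\pi}|f(t)|^p\,dt\big)^{1/p}$ for $1\le p<\infty$, $\|f\|_\infty=\operatorname{ess\,sup}_t|f(t)|$, and Fourier coefficients $\hat f(k)=\frac1{2\pi}\int_{-\pi}^{\pi}f(t)e^{-ikt}\,dt$. Let $r\in(0,1)$, $\alpha>0$, $1\le p<\infty$ and $\beta\in\mathbb R$, and put $\psi(k)=\exp(-\alpha k^r)$ for $k\in\mathbb N$. Let $L^{\alpha,r}_{\beta,p}$ be the class of all $f\in L_1$ for which there is $\varphi\in L_p$ with $\|\varphi\|_p\le 1$ and $\int_0^{2\pi}\varphi(t)\,dt=0$ whose Fourier series is $$\sum_{k\in\mathbb Z\setminus\{0\}}\frac{\hat f(k)}{\psi(|k|)}\,e^{i(kx+\frac{\beta\pi}{2}\operatorname{sign}k)}.$$ For $m\in\mathbb N$ let $$e^\perp_m(L^{\alpha,r}_{\beta,p})_\infty=\sup_{f\in L^{\alpha,r}_{\beta,p}}\ \inf_{\gamma_m}\Big\|f(\cdot)-\sum_{k\in\gamma_m}\hat f(k)e^{ik\cdot}\Big\|_\infty,$$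 the infimum being taken over all sets $\gamma_m$ of exactly $m$ integers. Then, for all $n\in\mathbb N=\{1,2,\dots\}$, $$e^\perp_{2n-1}(L^{\alpha,r}_{\beta,p})_\infty\asymp e^\perp_{2n}(L^{\alpha,r}_{\beta,p})_\infty\asymp \exp(-\alpha n^r)\,n^{\frac{1-r}{p}},$$ where $a_n\asymp b_n$ means that there are positive constants $C_1,C_2$, independent of $n$, with $C_1a_n\le b_n\le C_2a_n$ for all $n\in\mathbb N$. -/

import Mathlib

open MeasureTheory
open scoped ENNReal Real

noncomputable section

/-- The circle `ℝ / 2πℤ`: functions on it are the `2π`-periodic functions. Its measure `volume`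
is Lebesgue measure of total mass `2π`, so `eLpNorm f p volume` is the unnormalised norm
`(∫_0^{2π} |f(t)|^p dt)^{1/p}` (the essential supremum of `|f|` for `p = ∞`). -/
abbrev Circ : Type := AddCircle (2 * π)

instance factTwoPiPos : Fact (0 < 2 * π) := ⟨Real.two_pi_pos⟩

/-- The Fourier coefficient `(1/2π) ∫_{-π}^{π} f(t) e^{-ikt} dt` of a real periodic function. -/
def fhat (f : Circ → ℝ) (k : ℤ) : ℂ :=
  fourierCoeff (fun x => (f x : ℂ)) k

/-- `φ` is the `(ψ, β)`-derivative of `f`: `φ ∈ L₁` and its Fourier series is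
`∑_{k ≠ 0} (f̂(k) / ψ(|k|)) e^{i (k x + (β π / 2) sign k)}`. -/
def IsPsiBetaDeriv (ψ : ℕ → ℝ) (β : ℝ) (f φ : Circ → ℝ) : Prop :=
  MemLp φ 1 volume ∧
    fhat φ 0 = 0 ∧
    ∀ k : ℤ, k ≠ 0 →
      fhat φ k = fhat f k / (ψ k.natAbs : ℂ) *
        Complex.exp (Complex.I * ((β * π / 2 : ℝ) : ℂ) * (k.sign : ℂ))

/-- `B_p^0`: the functions in the closed unit ball of `L_p` that are orthogonal to constants. -/
def unitBallZero (p : ℝ≥0∞) : Set (Circ → ℝ) :=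
  {φ | MemLp φ p volume ∧ eLpNorm φ p volume ≤ 1 ∧ ∫ x, φ x = 0}

/-- The class `L^ψ_{β,p}` of functions in `L₁` with a `(ψ, β)`-derivative in `B_p^0`. -/
def classL (ψ : ℕ → ℝ) (β : ℝ) (p : ℝ≥0∞) : Set (Circ → ℝ) :=
  {f | MemLp f 1 volume ∧ ∃ φ, IsPsiBetaDeriv ψ β f φ ∧ φ ∈ unitBallZero p}

/-- The sequence `ψ(k) = exp (-α k^r)`. -/
def psiExp (α r : ℝ) (k : ℕ) : ℝ :=
  Real.exp (-α * (k : ℝ) ^ r)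

/-- `S_γ(f; x) = ∑_{k ∈ γ} f̂(k) e^{ikx}`. -/
def partialSum (γ : Finset ℤ) (f : Circ → ℝ) (x : Circ) : ℂ :=
  ∑ k ∈ γ, fhat f k * fourier k x

/-- `e^⊥_m(f)_s`: the best orthogonal trigonometric approximation of `f` in `L_s`, the infimum of
`‖f - S_γ(f)‖_s` over all sets `γ` of exactly `m` integers. -/
def orthApprox (m : ℕ) (s : ℝ≥0∞) (f : Circ → ℝ) : ℝ≥0∞ :=
  ⨅ (γ : Finset ℤ) (_ : γ.card = m),
    eLpNorm (fun x => (f x : ℂ) - partialSum γ f x) s volume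

/-- `e^⊥_m(F)_s = sup_{f ∈ F} e^⊥_m(f)_s`. -/
def orthApproxClass (m : ℕ) (s : ℝ≥0∞) (F : Set (Circ → ℝ)) : ℝ≥0∞ :=
  ⨆ f ∈ F, orthApprox m s f

/-- `a_n ≍ b_n` (for all `n ≥ 1`): there are finite positive constants `C₁, C₂`, independent of
`n`, with `C₁ a_n ≤ b_n ≤ C₂ a_n` for all `n ≥ 1`. -/
def SameOrder (a b : ℕ → ℝ≥0∞) : Prop :=
  ∃ C₁ C₂ : ℝ, 0 < C₁ ∧ 0 < C₂ ∧ ∀ n : ℕ, 1 ≤ n →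
    ENNReal.ofReal C₁ * a n ≤ b n ∧ b n ≤ ENNReal.ofReal C₂ * a n

end

noncomputable section

/-! Put N = n^(1-r). The logarithmic slope of ψ at n is -α r / N, so ψ(k) stays comparable to ψ(n)
for about N harmonics beyond n. Both bounds have size ψ(n) N^(1/p).

Upper bound: drop the harmonics |k| < n (and one more when m = 2n). Up to a phase, what remains is
twice the real part of the convolution of φ with the one-sided kernel ∑_{k ≥ n} ψ(k) e^{iky}. The
triangle inequality bounds this kernel by a multiple of ψ(n) N, summation by parts by a multiple of
ψ(n)/|y|; together they give the peak ψ(n) N / (1 + N|y|) (`exists_norm_tailKernel_le`). Its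
conjugate-exponent norm is of order ψ(n) N^(1/p), and Hölder's inequality finishes
(`exists_integral_abs_mul_peak_le`).

Lower bound: one function defeats every choice of m ≤ 2n harmonics. Take φ proportional to cos(Mt +
θ) P_q(t) minus its mean, with P_q the Poisson kernel, log q = -α r / N and θ = βπ/2. The L_p norm
before scaling is at most of order N^(1-1/p). The phase θ undoes the rotation by β, so the
coefficients of f have nonnegative real part; since log q is the slope of log ψ at n, the tangent
inequality makes at least 2n + 2N of them at least a constant times ψ(n) N^(1/p - 1). Deleting m of
them leaves at least 2N, which add up at x = 0 (`ofReal_le_orthApprox_trigSeries`,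
`exists_le_orthApproxClass`). -/

/-! ### Uniqueness of Fourier coefficients in L₁ and absolutely convergent series. -/

theorem integral_smul_continuousMap_eq_zero {g : Circ → ℂ}
    (hg : Integrable g AddCircle.haarAddCircle) (h0 : ∀ k, fourierCoeff g k = 0) (u : C(Circ, ℂ)) :
    ∫ x, u x * g x ∂AddCircle.haarAddCircle = 0 := by
  have hmul (v : C(Circ, ℂ)) : Integrable (fun x => v x * g x) AddCircle.haarAddCircle :=
    hg.bdd_mul v.continuous.aestronglyMeasurable (Filter.Eventually.of_forall v.norm_coe_le_norm)
  let Φ : C(Circ, ℂ) →ₗ[ℂ] ℂ :=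
    { toFun := fun v => ∫ x, v x * g x ∂AddCircle.haarAddCircle
      map_add' := fun v w => by
        simp only [ContinuousMap.add_apply, add_mul]
        exact integral_add (hmul v) (hmul w)
      map_smul' := fun c v => by
        simp only [ContinuousMap.smul_apply, smul_eq_mul, mul_assoc, RingHom.id_apply]
        exact integral_const_mul _ _ }
  -- Continuity in the sup norm lets vanishing pass from trigonometric polynomials to their closure,
  -- which is all of C.
  have hbound (v : C(Circ, ℂ)) :
      ‖Φ v‖ ≤ (∫ x, ‖g x‖ ∂AddCircle.haarAddCircle) * ‖v‖ := by
    calc ‖Φ v‖ ≤ ∫ x, ‖v x * g x‖ ∂AddCircle.haarAddCircle := norm_integral_le_integral_norm _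
      _ ≤ ∫ x, ‖g x‖ * ‖v‖ ∂AddCircle.haarAddCircle := by
        refine integral_mono (hmul v).norm (hg.norm.mul_const _) fun x => ?_
        simp only [norm_mul]
        exact (mul_comm _ _).trans_le
          (mul_le_mul_of_nonneg_left (v.norm_coe_le_norm x) (norm_nonneg _))
      _ = _ := integral_mul_const _ _
  let Ψ : C(Circ, ℂ) →L[ℂ] ℂ := Φ.mkContinuous _ hbound
  have hclosed : IsClosed {v | Ψ v = 0} := isClosed_eq Ψ.continuous continuous_const
  have hsub : (Submodule.span ℂ (Set.range (@fourier (2 * π)))).topologicalClosure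
      ≤ LinearMap.ker (Ψ : C(Circ, ℂ) →ₗ[ℂ] ℂ) := by
    refine Submodule.topologicalClosure_minimal _ (Submodule.span_le.2 ?_) ?_
    · rintro _ ⟨k, rfl⟩
      have := h0 (-k)
      simp only [fourierCoeff, neg_neg, smul_eq_mul] at this
      exact this
    · exact hclosed
  rw [span_fourier_closure_eq_top] at hsub
  exact hsub (Submodule.mem_top (x := u))

/-- Indicators of closed sets are pointwise limits of continuous functions bounded by 1, so g
integrates to zero over every closed set. -/
theorem ae_eq_zero_of_fourierCoeff_eq_zero {g : Circ → ℂ}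
    (hg : Integrable g AddCircle.haarAddCircle) (h0 : ∀ k, fourierCoeff g k = 0) :
    g =ᵐ[AddCircle.haarAddCircle] 0 := by
  refine ae_eq_zero_of_forall_setIntegral_isClosed_eq_zero hg fun s hs => ?_
  have hpos (n : ℕ) : (0 : ℝ) < 1 / (n + 1) := Nat.one_div_pos_of_nat
  let v (n : ℕ) : C(Circ, ℂ) :=
    ⟨fun x => ((thickenedIndicator (hpos n) s x : NNReal) : ℂ), by fun_prop⟩
  have hv (n : ℕ) : ∫ x, v n x * g x ∂AddCircle.haarAddCircle = 0 :=
    integral_smul_continuousMap_eq_zero hg h0 (v n)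
  have hlim : Filter.Tendsto (fun n => ∫ x, v n x * g x ∂AddCircle.haarAddCircle) Filter.atTop
      (nhds (∫ x, s.indicator g x ∂AddCircle.haarAddCircle)) := by
    refine tendsto_integral_of_dominated_convergence (fun x => ‖g x‖)
      (fun n => (v n).continuous.aestronglyMeasurable.mul hg.1) hg.norm (fun n => ?_) ?_
    · refine Filter.Eventually.of_forall fun x => ?_
      rw [norm_mul]
      refine mul_le_of_le_one_left (norm_nonneg _) ?_
      simp only [v, ContinuousMap.coe_mk, Complex.norm_real, NNReal.norm_eq]
      exact_mod_cast thickenedIndicator_le_one (hpos n) s x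
    · refine Filter.Eventually.of_forall fun x => ?_
      have h1 := thickenedIndicator_tendsto_indicator_closure (fun n => hpos n)
        tendsto_one_div_add_atTop_nhds_zero_nat s
      rw [tendsto_pi_nhds] at h1
      have h2 := h1 x
      rw [hs.closure_eq] at h2
      have h3 : Filter.Tendsto (fun n => v n x) Filter.atTop
          (nhds (((s.indicator (fun _ => (1 : NNReal)) x : NNReal) : ℝ) : ℂ)) :=
        (Complex.continuous_ofReal.comp NNReal.continuous_coe).continuousAt.tendsto.comp h2
      have h4 := h3.mul_const (g x)
      convert h4 using 2
      by_cases hx : x ∈ s <;> simp [hx]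
  simp only [hv] at hlim
  rw [← integral_indicator hs.measurableSet]
  exact (tendsto_nhds_unique hlim tendsto_const_nhds)

theorem norm_fourier_apply (k : ℤ) (x : Circ) : ‖fourier k x‖ = 1 := by
  rw [fourier_apply]
  exact Circle.norm_coe _

theorem norm_mul_fourier (a : ℤ → ℂ) (k : ℤ) (x : Circ) : ‖a k * fourier k x‖ = ‖a k‖ := by
  rw [norm_mul, norm_fourier_apply, mul_one]

theorem summable_mul_fourier {a : ℤ → ℂ} (ha : Summable a) (x : Circ) :
    Summable fun k => a k * fourier k x := by
  refine .of_norm ?_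
  simpa only [norm_mul_fourier] using ha.norm

theorem continuous_tsum_fourier {a : ℤ → ℂ} (ha : Summable a) :
    Continuous fun x : Circ => ∑' k, a k * fourier k x :=
  continuous_tsum (fun k => by fun_prop) ha.norm fun k x => (norm_mul_fourier a k x).le

theorem fourierCoeff_tsum_fourier {a : ℤ → ℂ} (ha : Summable a) (m : ℤ) :
    fourierCoeff (fun x : Circ => ∑' k, a k * fourier k x) m = a m := by
  have hcont (k : ℤ) : Continuous fun x : Circ => fourier (-m) x * (a k * fourier k x) := by
    fun_prop
  have h := hasSum_integral_of_summable_integral_norm (μ := AddCircle.haarAddCircle)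
    (F := fun k (x : Circ) => fourier (-m) x * (a k * fourier k x))
    (fun k => (hcont k).integrable_of_hasCompactSupport (.of_compactSpace _)) (by
      simpa [norm_fourier_apply, -fourier_apply] using ha.norm)
  have h2 : (fun k => ∫ x : Circ, fourier (-m) x * (a k * fourier k x) ∂AddCircle.haarAddCircle)
      = fun k => if k = m then a m else 0 := by
    funext k
    have h3 := congrFun (fourierCoeff_fourier (T := 2 * π) k) m
    simp only [fourierCoeff, smul_eq_mul] at h3
    have h4 (x : Circ) : fourier (-m) x * (a k * fourier k x)
      = a k * (fourier (-m) x * fourier k x) := by ring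
    simp only [h4]
    rw [integral_const_mul, h3]
    by_cases hk : k = m
    · simp [hk]
    · simp [hk, Ne.symm hk]
  rw [h2] at h
  have h5 := h.unique (hasSum_ite_eq m (a m))
  simpa [fourierCoeff, tsum_mul_left] using h5

theorem integrable_haarAddCircle_iff {E : Type*} [NormedAddCommGroup E] {g : Circ → E} :
    Integrable g AddCircle.haarAddCircle ↔ Integrable g volume := by
  rw [AddCircle.volume_eq_smul_haarAddCircle, integrable_smul_measure]
  · simpa using Real.pi_pos
  · exact ENNReal.ofReal_ne_top

theorem ae_haarAddCircle_iff {P : Circ → Prop} :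
    (∀ᵐ x ∂AddCircle.haarAddCircle, P x) ↔ ∀ᵐ x : Circ, P x := by
  rw [AddCircle.volume_eq_smul_haarAddCircle, Measure.ae_ennreal_smul_measure_iff]
  simpa using Real.pi_pos

/-- The difference of the two sides is integrable with all coefficients zero. This lets a class
member, known only through its coefficients, be replaced by its series. -/
theorem ae_eq_tsum_fourierCoeff {g : Circ → ℂ} (hg : Integrable g volume)
    (hs : Summable (fourierCoeff g)) :
    ∀ᵐ x : Circ, g x = ∑' k, fourierCoeff g k * fourier k x := by
  have hg' := integrable_haarAddCircle_iff.2 hg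
  have hF : Integrable (fun x : Circ => ∑' k, fourierCoeff g k * fourier k x)
      AddCircle.haarAddCircle :=
    (continuous_tsum_fourier hs).integrable_of_hasCompactSupport (.of_compactSpace _)
  have h := ae_eq_zero_of_fourierCoeff_eq_zero (hg'.sub hF) fun k => by
    have h1 := fourierCoeff.const_smul (fun x : Circ => ∑' k, fourierCoeff g k * fourier k x) (-1) k
    have h2 := congrFun (fourierCoeff.add hg' (hF.smul (-1 : ℂ))) k
    rw [Pi.add_apply, h1, fourierCoeff_tsum_fourier hs] at h2
    rw [sub_eq_add_neg, ← neg_one_smul ℂ (fun x : Circ => ∑' k, fourierCoeff g k * fourier k x)]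
    refine h2.trans ?_
    simp
  rw [← ae_haarAddCircle_iff]
  filter_upwards [h] with x hx
  simpa [sub_eq_zero] using hx

/-! ### Elementary coefficient facts and the splitting of a series over ℤ at ±n. -/

theorem norm_fhat_le (φ : Circ → ℝ) (k : ℤ) :
    ‖fhat φ k‖ ≤ 1 / (2 * π) * ∫ x, |φ x| := by
  unfold fhat fourierCoeff
  refine (norm_integral_le_integral_norm _).trans ?_
  simp only [norm_smul, norm_fourier_apply, one_mul, Complex.norm_real, Real.norm_eq_abs]
  rw [AddCircle.integral_haarAddCircle]
  simp

theorem fhat_neg (f : Circ → ℝ) (k : ℤ) : fhat f (-k) = (starRingEnd ℂ) (fhat f k) := by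
  unfold fhat fourierCoeff
  rw [← integral_conj]
  simp [smul_eq_mul, map_mul]

theorem tsum_int_eq_sum_Ioo_add {u : ℤ → ℂ} (hu : Summable u) (n : ℕ) (hn : 1 ≤ n) :
    ∑' k, u k = ∑ k ∈ Finset.Ioo (-n : ℤ) n, u k + ∑' j : ℕ, u (n + j)
      + ∑' j : ℕ, u (-(n + j)) := by
  have hpos : Summable fun j : ℕ => u j := hu.comp_injective Nat.cast_injective
  have hneg : Summable fun j : ℕ => u (-j) :=
    hu.comp_injective (i := fun j : ℕ => -(j : ℤ)) fun a b h => by simpa using h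
  induction n, hn using Nat.le_induction with
  | base =>
    have h1 : Summable fun j : ℕ => u (-(j + 1)) := by
      have := (summable_nat_add_iff 1).2 hneg
      simpa using this
    have h := (HasSum.of_nat_of_neg_add_one hpos.hasSum h1.hasSum).tsum_eq
    rw [h, hpos.tsum_eq_zero_add]
    have : Finset.Ioo (-1 : ℤ) 1 = {0} := by decide
    simp [this, add_comm]
  | succ n hn ih =>
    have hp : Summable fun j : ℕ => u (n + j) := by
      have := (summable_nat_add_iff n).2 hpos
      simpa [add_comm] using this
    have hm : Summable fun j : ℕ => u (-(n + j)) := by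
      have := (summable_nat_add_iff n).2 hneg
      simpa [add_comm] using this
    rw [ih, hp.tsum_eq_zero_add, hm.tsum_eq_zero_add]
    have hI : Finset.Ioo (-((n + 1 : ℕ) : ℤ)) ((n + 1 : ℕ) : ℤ)
        = insert (n : ℤ) (insert (-n : ℤ) (Finset.Ioo (-n : ℤ) n)) := by
      ext k
      simp only [Finset.mem_Ioo, Finset.mem_insert]
      push_cast
      omega
    rw [hI, Finset.sum_insert, Finset.sum_insert]
    · simp only [Nat.cast_zero, add_zero, Nat.cast_add, Nat.cast_one, add_comm, add_left_comm,
        add_assoc]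
    · simp
    · simp only [Finset.mem_insert, Finset.mem_Ioo]
      omega

/-! ### Decay of ψ beyond n and the size of its tails. -/

theorem summable_exp_neg_mul_rpow {c r : ℝ} (hc : 0 < c) (hr : 0 < r) :
    Summable fun j : ℕ => Real.exp (-c * (j : ℝ) ^ r) := by
  have h1 := (isLittleO_exp_neg_mul_rpow_atTop hc (-2 / r)).isBigO.comp_tendsto
    ((tendsto_rpow_atTop hr).comp tendsto_natCast_atTop_atTop)
  refine summable_of_isBigO_nat (g := fun j : ℕ => (j : ℝ) ^ (-2 : ℝ)) ?_ ?_
  · exact Real.summable_nat_rpow.2 (by norm_num)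
  · refine h1.congr_right fun j => ?_
    simp only [Function.comp]
    rw [← Real.rpow_mul (Nat.cast_nonneg j)]
    congr 1
    field_simp

/-- Concavity: the graph lies below its tangent at x. Used at x = n + j for the decay of ψ, and at x
= n for the lower bound. -/
theorem rpow_le_tangent {r x y : ℝ} (hr0 : 0 ≤ r) (hr1 : r ≤ 1) (hx : 0 < x) (hy : 0 ≤ y) :
    y ^ r ≤ x ^ r + r * x ^ (r - 1) * (y - x) := by
  have h := rpow_one_add_le_one_add_mul_self (s := y / x - 1)
    (by linarith [div_nonneg hy hx.le]) hr0 hr1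
  rw [add_sub_cancel, Real.div_rpow hy hx.le] at h
  have hxr : 0 < x ^ r := Real.rpow_pos_of_pos hx r
  rw [div_le_iff₀ hxr] at h
  refine h.trans_eq ?_
  rw [Real.rpow_sub_one hx.ne']
  field_simp

theorem one_div_one_sub_exp_neg_le {y : ℝ} (hy : 0 < y) :
    1 / (1 - Real.exp (-y)) ≤ 1 + 1 / y := by
  have h1 := Real.add_one_le_exp y
  have h2 : Real.exp (-y) ≤ 1 / (y + 1) := by
    rw [Real.exp_neg, ← one_div]
    exact one_div_le_one_div_of_le (by linarith) h1
  have h3 : y / (y + 1) ≤ 1 - Real.exp (-y) := by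
    have : y / (y + 1) = 1 - 1 / (y + 1) := by field_simp; ring
    linarith
  calc 1 / (1 - Real.exp (-y)) ≤ 1 / (y / (y + 1)) :=
        one_div_le_one_div_of_le (by positivity) h3
    _ = 1 + 1 / y := by field_simp

theorem psiExp_pos (α r : ℝ) (k : ℕ) : 0 < psiExp α r k := Real.exp_pos _

theorem psiExp_antitone {α r : ℝ} (hα : 0 < α) (hr : 0 < r) : Antitone (psiExp α r) := by
  intro a b hab
  refine Real.exp_le_exp.2 ?_
  have : (a : ℝ) ^ r ≤ (b : ℝ) ^ r :=
    Real.rpow_le_rpow (Nat.cast_nonneg a) (by exact_mod_cast hab) hr.le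
  nlinarith

theorem one_le_natCast_rpow {n : ℕ} (hn : 1 ≤ n) {s : ℝ} (hs : 0 ≤ s) : 1 ≤ (n : ℝ) ^ s :=
  Real.one_le_rpow (by exact_mod_cast hn) hs

/-- The first summand is geometric with ratio 1 - O(1/N), so it sums to O(N); the second has a sum
independent of n. -/
theorem psiExp_add_le {α r : ℝ} (hα : 0 < α) (hr0 : 0 < r) (hr1 : r < 1) {n : ℕ} (hn : 1 ≤ n)
    (j : ℕ) :
    psiExp α r (n + j) ≤ psiExp α r n *
      (Real.exp (-(α * r / 2 / (n : ℝ) ^ (1 - r))) ^ j + Real.exp (-(α * r / 2) * (j : ℝ) ^ r)) := by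
  have hn0 : (0 : ℝ) < n := by exact_mod_cast hn
  have hj0 : (0 : ℝ) ≤ j := Nat.cast_nonneg j
  set N := (n : ℝ) ^ (1 - r) with hN
  have hNpos : 0 < N := Real.rpow_pos_of_pos hn0 _
  have hk : (0 : ℝ) < n + j := by positivity
  have htan := rpow_le_tangent hr0.le hr1.le hk hn0.le
  set u := ((n : ℝ) + j) ^ (r - 1) with hu
  set W := (j : ℝ) ^ (1 - r) with hW
  have hW0 : 0 ≤ W := Real.rpow_nonneg hj0 _
  -- Subadditivity of t^(1-r) turns the tangent slope at n + j into at least r / (N + W).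
  have hsub : ((n : ℝ) + j) ^ (1 - r) ≤ N + W :=
    Real.rpow_add_le_add_rpow hn0.le hj0 (by linarith) (by linarith)
  have hu_eq : u = (((n : ℝ) + j) ^ (1 - r))⁻¹ := by
    rw [hu, ← Real.rpow_neg hk.le]; congr 1; ring
  have hu_ge : (N + W)⁻¹ ≤ u := by
    rw [hu_eq]
    exact inv_anti₀ (Real.rpow_pos_of_pos hk _) hsub
  have hmain : r * j * (N + W)⁻¹ ≤ ((n : ℝ) + j) ^ r - (n : ℝ) ^ r := by
    have : r * j * (N + W)⁻¹ ≤ r * j * u := mul_le_mul_of_nonneg_left hu_ge (by positivity)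
    nlinarith
  have hcase : Real.exp (-(α * (r * j * (N + W)⁻¹))) ≤
      Real.exp (-(α * r / 2 / N)) ^ j + Real.exp (-(α * r / 2) * (j : ℝ) ^ r) := by
    -- If W ≤ N, the exponent is at least linear in j / N; otherwise j / W = j^r gives the stretched
    -- exponential.
    rcases le_total W N with h | h
    · refine le_trans ?_ (le_add_of_nonneg_right (Real.exp_pos _).le)
      rw [← Real.exp_nat_mul]
      refine Real.exp_le_exp.2 ?_
      have h1 : (2 * N)⁻¹ ≤ (N + W)⁻¹ := inv_anti₀ (by linarith) (by linarith)
      have h2 : α * (r * j) * (2 * N)⁻¹ ≤ α * (r * j) * (N + W)⁻¹ :=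
        mul_le_mul_of_nonneg_left h1 (by positivity)
      have h3 : (j : ℝ) * -(α * r / 2 / N) = -(α * (r * j) * (2 * N)⁻¹) := by
        field_simp
      rw [h3]
      linarith
    · refine le_trans ?_ (le_add_of_nonneg_left (by positivity))
      refine Real.exp_le_exp.2 ?_
      have hWpos : 0 < W := hNpos.trans_le h
      have hjpos : (0 : ℝ) < j := by
        rcases hj0.eq_or_lt with h0 | h0
        · rw [hW, ← h0, Real.zero_rpow (by linarith)] at hWpos
          exact absurd hWpos (lt_irrefl _)
        · exact h0
      have h1 : (2 * W)⁻¹ ≤ (N + W)⁻¹ := inv_anti₀ (by linarith) (by linarith)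
      have h2 : α * (r * j) * (2 * W)⁻¹ ≤ α * (r * j) * (N + W)⁻¹ :=
        mul_le_mul_of_nonneg_left h1 (by positivity)
      have h3 : (j : ℝ) = (j : ℝ) ^ r * W := by
        rw [hW, ← Real.rpow_add hjpos]; simp
      have h4 : α * (r * j) * (2 * W)⁻¹ = α * r / 2 * (j : ℝ) ^ r := by
        have h5 : (j : ℝ) * W⁻¹ = (j : ℝ) ^ r := by
          rw [eq_comm, eq_mul_inv_iff_mul_eq₀ hWpos.ne', ← h3]
        rw [mul_inv, ← h5]; ring
      linarith
  unfold psiExp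
  calc Real.exp (-α * ((n + j : ℕ) : ℝ) ^ r)
      ≤ Real.exp (-α * (n : ℝ) ^ r + -(α * (r * j * (N + W)⁻¹))) := by
        refine Real.exp_le_exp.2 ?_
        push_cast
        nlinarith
    _ = Real.exp (-α * (n : ℝ) ^ r) * Real.exp (-(α * (r * j * (N + W)⁻¹))) := Real.exp_add _ _
    _ ≤ _ := mul_le_mul_of_nonneg_left hcase (Real.exp_pos _).le

theorem summable_psiExp_add {α r : ℝ} (hα : 0 < α) (hr0 : 0 < r) (n : ℕ) :
    Summable fun j : ℕ => psiExp α r (n + j) := by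
  have := (summable_nat_add_iff n).2 (summable_exp_neg_mul_rpow hα hr0)
  simpa only [psiExp, add_comm n] using this

theorem exists_tsum_psiExp_add_le {α r : ℝ} (hα : 0 < α) (hr0 : 0 < r) (hr1 : r < 1) :
    ∃ C : ℝ, 0 < C ∧ ∀ n : ℕ, 1 ≤ n →
      ∑' j : ℕ, psiExp α r (n + j) ≤ C * psiExp α r n * (n : ℝ) ^ (1 - r) := by
  set c := α * r / 2 with hc
  have hcpos : 0 < c := by positivity
  set S := ∑' j : ℕ, Real.exp (-c * (j : ℝ) ^ r)
  have hS0 : 0 ≤ S := tsum_nonneg fun j => (Real.exp_pos _).le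
  refine ⟨1 + 1 / c + S, by positivity, fun n hn => ?_⟩
  have hN1 : 1 ≤ (n : ℝ) ^ (1 - r) := one_le_natCast_rpow hn (by linarith)
  set N := (n : ℝ) ^ (1 - r)
  have hy : 0 < c / N := by positivity
  have hlt : Real.exp (-(c / N)) < 1 := by
    rw [← Real.exp_zero]
    exact Real.exp_lt_exp.2 (by linarith)
  have hgeo := summable_geometric_of_lt_one (Real.exp_pos (-(c / N))).le hlt
  have hexp := summable_exp_neg_mul_rpow hcpos hr0
  calc ∑' j : ℕ, psiExp α r (n + j)
      ≤ ∑' j : ℕ, psiExp α r n *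
        (Real.exp (-(c / N)) ^ j + Real.exp (-c * (j : ℝ) ^ r)) :=
        (summable_psiExp_add hα hr0 n).tsum_le_tsum (fun j => psiExp_add_le hα hr0 hr1 hn j)
          ((hgeo.add hexp).mul_left _)
    _ = psiExp α r n * ((1 - Real.exp (-(c / N)))⁻¹ + S) := by
        rw [tsum_mul_left, hgeo.tsum_add hexp, tsum_geometric_of_lt_one (Real.exp_pos _).le hlt]
    _ ≤ psiExp α r n * ((1 + 1 / c + S) * N) := by
        refine mul_le_mul_of_nonneg_left ?_ (psiExp_pos _ _ _).le
        have h1 := one_div_one_sub_exp_neg_le hy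
        rw [one_div, one_div_div] at h1
        have h2 : N / c = 1 / c * N := by ring
        nlinarith
    _ = _ := by ring

/-! ### Pointwise bound for the tail kernel. -/

/-- Summation by parts: multiplying by 1 - z leaves a 0 minus a series whose coefficients are the
nonnegative differences of `a`, which telescope to a 0. -/
theorem norm_one_sub_mul_tsum_le {a : ℕ → ℝ} (ha : Summable a) (hanti : Antitone a) {z : ℂ}
    (hz : ‖z‖ = 1) : ‖1 - z‖ * ‖∑' j, (a j : ℂ) * z ^ j‖ ≤ 2 * a 0 := by
  have hterm : Summable fun j => (a j : ℂ) * z ^ j := by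
    refine .of_norm ?_
    simpa [hz] using ha.norm
  have hterm' : Summable fun j => (a j : ℂ) * z ^ (j + 1) := by
    simpa only [pow_succ, mul_assoc] using hterm.mul_right z
  have hshift : Summable fun j => a (j + 1) := (summable_nat_add_iff 1).2 ha
  have hterm1 : Summable fun j => (a (j + 1) : ℂ) * z ^ (j + 1) :=
    (summable_nat_add_iff 1).2 hterm
  have hd : Summable fun j => a j - a (j + 1) := ha.sub hshift
  have htel : ∑' j, (a j - a (j + 1)) = a 0 := by
    rw [ha.tsum_sub hshift, ha.tsum_eq_zero_add]; ring
  have hid : (1 - z) * ∑' j, (a j : ℂ) * z ^ j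
      = a 0 - ∑' j, ((a j - a (j + 1) : ℝ) : ℂ) * z ^ (j + 1) := by
    have h1 : ∑' j, ((a j - a (j + 1) : ℝ) : ℂ) * z ^ (j + 1)
        = z * ∑' j, (a j : ℂ) * z ^ j - ∑' j, (a (j + 1) : ℂ) * z ^ (j + 1) := by
      rw [← tsum_mul_left, ← Summable.tsum_sub (hterm.mul_left z) hterm1]
      refine tsum_congr fun j => ?_
      push_cast
      ring
    rw [h1, sub_mul, one_mul]
    nth_rewrite 1 [hterm.tsum_eq_zero_add]
    simp
    ring
  have hnonneg : 0 ≤ a 0 := by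
    rw [← htel]; exact tsum_nonneg fun j => sub_nonneg.2 (hanti j.le_succ)
  rw [← norm_mul, hid]
  refine (norm_sub_le _ _).trans ?_
  have hb : ‖∑' j, ((a j - a (j + 1) : ℝ) : ℂ) * z ^ (j + 1)‖ ≤ a 0 := by
    rw [← htel]
    refine tsum_of_norm_bounded hd.hasSum fun j => ?_
    rw [norm_mul, norm_pow, hz, one_pow, mul_one, Complex.norm_real, Real.norm_eq_abs,
      abs_of_nonneg (sub_nonneg.2 (hanti j.le_succ))]
  rw [Complex.norm_real, Real.norm_eq_abs, abs_of_nonneg hnonneg]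
  linarith

theorem norm_coe_circ {t : ℝ} (ht : |t| ≤ π) : ‖(t : Circ)‖ = |t| := by
  rw [AddCircle.norm_coe_eq_abs_iff _ Real.two_pi_pos.ne', abs_of_pos Real.two_pi_pos]
  linarith

theorem two_div_pi_mul_norm_le (y : Circ) : 2 / π * ‖y‖ ≤ ‖1 - fourier 1 y‖ := by
  obtain ⟨t, ht, rfl⟩ : ∃ t ∈ Set.Ioc (-π) (-π + 2 * π), (t : Circ) = y := by
    have := AddCircle.coe_image_Ioc_eq (2 * π) (-π)
    have hy : y ∈ ((↑) : ℝ → Circ) '' Set.Ioc (-π) (-π + 2 * π) := by rw [this]; trivial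
    exact hy
  have habs : |t| ≤ π := abs_le.2 ⟨ht.1.le, by linarith [ht.2]⟩
  have hpi := Real.pi_pos
  have hnorm := norm_coe_circ habs
  have hf : (fourier 1 (t : Circ) : ℂ) = Complex.exp (Complex.I * t) := by
    rw [fourier_coe_apply]
    congr 1
    push_cast
    field_simp
  rw [hnorm, hf, norm_sub_rev, Complex.norm_exp_I_mul_ofReal_sub_one, norm_mul, Real.norm_eq_abs,
    Real.norm_eq_abs]
  have h := Real.mul_abs_le_abs_sin (x := t / 2) (by
    rw [abs_div, abs_two]; linarith)
  rw [abs_div, abs_two] at h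
  rw [abs_two]
  linarith

theorem fourier_natCast_add (n j : ℕ) (y : Circ) :
    (fourier (n + j : ℤ) y : ℂ) = fourier n y * fourier 1 y ^ j := by
  induction j with
  | zero => simp
  | succ j ih =>
    have : (n + (j + 1 : ℕ) : ℤ) = (n + j : ℤ) + 1 := by push_cast; ring
    rw [this, fourier_add, ih, pow_succ, mul_assoc]

theorem exists_norm_tailKernel_le {α r : ℝ} (hα : 0 < α) (hr0 : 0 < r) (hr1 : r < 1) :
    ∃ C : ℝ, 0 < C ∧ ∀ n : ℕ, 1 ≤ n → ∀ y : Circ,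
      ‖∑' j : ℕ, (psiExp α r (n + j) : ℂ) * fourier (n + j : ℤ) y‖ ≤
        C * psiExp α r n * ((n : ℝ) ^ (1 - r) / (1 + (n : ℝ) ^ (1 - r) * ‖y‖)) := by
  obtain ⟨C, hC, hsum⟩ := exists_tsum_psiExp_add_le hα hr0 hr1
  have hpi := Real.pi_pos
  refine ⟨C + π, by positivity, fun n hn y => ?_⟩
  have hNpos : 0 < (n : ℝ) ^ (1 - r) :=
    zero_lt_one.trans_le (one_le_natCast_rpow hn (by linarith))
  have h1 := hsum n hn
  set N := (n : ℝ) ^ (1 - r)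
  have hs := summable_psiExp_add (α := α) (r := r) hα hr0 n
  set K := ‖∑' j : ℕ, (psiExp α r (n + j) : ℂ) * fourier (n + j : ℤ) y‖ with hK
  have hK1 : K ≤ C * psiExp α r n * N := by
    refine le_trans ?_ h1
    refine tsum_of_norm_bounded hs.hasSum fun j => ?_
    rw [norm_mul, norm_fourier_apply, mul_one, Complex.norm_real, Real.norm_eq_abs,
      abs_of_pos (psiExp_pos _ _ _)]
  have hK2 : K = ‖∑' j : ℕ, (psiExp α r (n + j) : ℂ) * fourier 1 y ^ j‖ := by
    have : ∑' j : ℕ, (psiExp α r (n + j) : ℂ) * fourier (n + j : ℤ) y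
        = fourier n y * ∑' j : ℕ, (psiExp α r (n + j) : ℂ) * fourier 1 y ^ j := by
      rw [← tsum_mul_left]
      refine tsum_congr fun j => ?_
      rw [fourier_natCast_add]; ring
    rw [hK, this, norm_mul, norm_fourier_apply, one_mul]
  have hK3 : ‖y‖ * K ≤ π * psiExp α r n := by
    have h2 := norm_one_sub_mul_tsum_le (z := fourier 1 y) hs
      (fun a b hab => psiExp_antitone hα hr0 (by omega)) (norm_fourier_apply 1 y)
    rw [← hK2] at h2
    have h3 := mul_le_mul_of_nonneg_right (two_div_pi_mul_norm_le y) (norm_nonneg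
      (∑' j : ℕ, (psiExp α r (n + j) : ℂ) * fourier (n + j : ℤ) y))
    rw [← hK] at h3
    have h4 : 2 / π * ‖y‖ * K ≤ 2 * psiExp α r n := h3.trans h2
    have h5 : ‖y‖ * K = π / 2 * (2 / π * ‖y‖ * K) := by field_simp
    rw [h5]
    calc _ ≤ π / 2 * (2 * psiExp α r n) := mul_le_mul_of_nonneg_left h4 (by positivity)
      _ = _ := by ring
  -- The bound for K plus N times the bound for ‖y‖ K: this is where the constant C + π comes from.
  rw [mul_div_assoc', le_div_iff₀ (by positivity)]
  nlinarith

/-! ### Hölder's inequality against the peak N / (1 + N‖y‖). -/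

/-- Rescaling by u = N t reduces this to the integrability of (1 + |u|)^(-s) on the whole line. -/
theorem exists_integral_peak_rpow_le {s : ℝ} (hs : 1 < s) :
    ∃ C : ℝ, 0 < C ∧ ∀ N : ℝ, 0 < N →
      ∫ y : Circ, (N / (1 + N * ‖y‖)) ^ s ≤ C * N ^ (s - 1) := by
  have hint : Integrable (fun u : ℝ => (1 + ‖u‖) ^ (-s)) :=
    integrable_one_add_norm (by simpa using hs)
  set J := ∫ u : ℝ, (1 + ‖u‖) ^ (-s)
  have hJ : 0 ≤ J := integral_nonneg fun u => by positivity
  refine ⟨J + 1, by positivity, fun N hN => ?_⟩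
  have hpi := Real.pi_pos
  have heq (t : ℝ) : (N / (1 + N * |t|)) ^ s = N ^ s * (1 + ‖N * t‖) ^ (-s) := by
    rw [Real.div_rpow hN.le (by positivity), Real.norm_eq_abs, abs_mul, abs_of_pos hN,
      Real.rpow_neg (by positivity), div_eq_mul_inv]
  have hint2 : Integrable (fun t : ℝ => N ^ s * (1 + ‖N * t‖) ^ (-s)) :=
    (hint.comp_mul_left' hN.ne').const_mul _
  calc ∫ y : Circ, (N / (1 + N * ‖y‖)) ^ s
      = ∫ t in Set.Ioc (-π) (-π + 2 * π), (N / (1 + N * ‖(t : Circ)‖)) ^ s :=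
        (AddCircle.integral_preimage (2 * π) (-π) fun y : Circ => (N / (1 + N * ‖y‖)) ^ s).symm
    _ = ∫ t in Set.Ioc (-π) (-π + 2 * π), N ^ s * (1 + ‖N * t‖) ^ (-s) := by
        refine setIntegral_congr_fun measurableSet_Ioc fun t ht => ?_
        have habs : |t| ≤ π := abs_le.2 ⟨ht.1.le, by linarith [ht.2]⟩
        have hnorm := norm_coe_circ habs
        simp only [hnorm, heq]
    _ ≤ ∫ t : ℝ, N ^ s * (1 + ‖N * t‖) ^ (-s) :=
        setIntegral_le_integral hint2 (.of_forall fun t => by positivity)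
    _ = N ^ (s - 1) * J := by
        rw [integral_const_mul, Measure.integral_comp_mul_left (fun u : ℝ => (1 + ‖u‖) ^ (-s)) N,
          abs_of_pos (inv_pos.2 hN), smul_eq_mul, Real.rpow_sub_one hN.ne']
        ring
    _ ≤ (J + 1) * N ^ (s - 1) := by
        have : 0 < N ^ (s - 1) := Real.rpow_pos_of_pos hN _
        nlinarith

theorem integral_abs_rpow_le_one {p : ℝ} (hp : 1 ≤ p) {φ : Circ → ℝ}
    (hφ : MemLp φ (ENNReal.ofReal p) volume) (h1 : eLpNorm φ (ENNReal.ofReal p) volume ≤ 1) :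
    ∫ t, |φ t| ^ p ≤ 1 := by
  have hp0 : 0 < p := by linarith
  have h := hφ.eLpNorm_eq_integral_rpow_norm (by simpa using hp0) ENNReal.ofReal_ne_top
  rw [h, ENNReal.toReal_ofReal hp0.le] at h1
  have h2 : (∫ t, ‖φ t‖ ^ p) ^ p⁻¹ ≤ 1 := by simpa using h1
  have h3 : 0 ≤ ∫ t, ‖φ t‖ ^ p := integral_nonneg fun t => by positivity
  have h4 := Real.rpow_le_rpow (by positivity) h2 hp0.le
  rwa [Real.one_rpow, Real.rpow_inv_rpow h3 hp0.ne'] at h4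

theorem continuous_peak {N : ℝ} (hN : 0 < N) (x : Circ) :
    Continuous fun t : Circ => N / (1 + N * ‖x - t‖) := by
  refine continuous_const.div (by fun_prop) fun t => ?_
  positivity

theorem exists_integral_abs_mul_peak_le {p : ℝ} (hp : 1 ≤ p) :
    ∃ C : ℝ, 0 < C ∧ ∀ N : ℝ, 0 < N → ∀ φ : Circ → ℝ, MemLp φ (ENNReal.ofReal p) volume →
      eLpNorm φ (ENNReal.ofReal p) volume ≤ 1 → ∀ x : Circ,
        ∫ t, |φ t| * (N / (1 + N * ‖x - t‖)) ≤ C * N ^ (1 / p) := by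
  -- For p = 1 the conjugate exponent is infinite, and the sup bound N of the peak replaces Hölder.
  rcases hp.eq_or_lt with rfl | hp1
  · refine ⟨1, one_pos, fun N hN φ hφ h1 x => ?_⟩
    have h := integral_abs_rpow_le_one le_rfl hφ h1
    simp only [Real.rpow_one] at h
    have hint : Integrable φ volume := by simpa using (memLp_one_iff_integrable.1 (by simpa using hφ))
    have hle (t : Circ) : N / (1 + N * ‖x - t‖) ≤ N :=
      div_le_self hN.le (by nlinarith [norm_nonneg (x - t)])
    calc ∫ t, |φ t| * (N / (1 + N * ‖x - t‖)) ≤ ∫ t, |φ t| * N := by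
          refine integral_mono_of_nonneg (.of_forall fun t => by positivity)
            (hint.abs.mul_const N) (.of_forall fun t => ?_)
          exact mul_le_mul_of_nonneg_left (hle t) (abs_nonneg _)
      _ = (∫ t, |φ t|) * N := integral_mul_const _ _
      _ ≤ 1 * N := mul_le_mul_of_nonneg_right h hN.le
      _ = 1 * N ^ (1 / (1 : ℝ)) := by simp
  · have hq := Real.HolderConjugate.conjExponent hp1
    set q := p.conjExponent
    obtain ⟨C, hC, hpeak⟩ := exists_integral_peak_rpow_le hq.symm.lt
    refine ⟨C ^ (1 / q), by positivity, fun N hN φ hφ h1 x => ?_⟩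
    have h := integral_abs_rpow_le_one hp hφ h1
    have hcont := continuous_peak hN x
    have hmem : MemLp (fun t : Circ => N / (1 + N * ‖x - t‖)) (ENNReal.ofReal q) volume :=
      hcont.memLp_of_hasCompactSupport (.of_compactSpace _)
    have hH := integral_mul_le_Lp_mul_Lq_of_nonneg hq (f := fun t => |φ t|)
      (.of_forall fun t => abs_nonneg _) (.of_forall fun t : Circ => by
        show 0 ≤ N / (1 + N * ‖x - t‖)
        positivity) hφ.norm hmem
    refine hH.trans ?_
    have htrans : ∫ t : Circ, (N / (1 + N * ‖x - t‖)) ^ q = ∫ y : Circ, (N / (1 + N * ‖y‖)) ^ q :=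
      integral_sub_left_eq_self (fun y : Circ => (N / (1 + N * ‖y‖)) ^ q) volume x
    rw [htrans]
    have ha : (∫ t, |φ t| ^ p) ^ (1 / p) ≤ 1 :=
      Real.rpow_le_one (integral_nonneg fun t => by positivity) h (by positivity)
    have hq0 : 0 < q := hq.symm.pos
    have hb : (∫ y : Circ, (N / (1 + N * ‖y‖)) ^ q) ^ (1 / q) ≤ C ^ (1 / q) * N ^ (1 / p) := by
      have h2 := Real.rpow_le_rpow (integral_nonneg fun y : Circ => by positivity) (hpeak N hN)
        (z := 1 / q) (by positivity)
      rw [Real.mul_rpow hC.le (by positivity), ← Real.rpow_mul hN.le] at h2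
      have h3 : (q - 1) * (1 / q) = 1 / p := by
        have := hq.inv_add_inv_eq_one
        have hp0 : p ≠ 0 := by linarith
        field_simp at this ⊢
        linarith
      rwa [h3] at h2
    calc _ ≤ 1 * (∫ y : Circ, (N / (1 + N * ‖y‖)) ^ q) ^ (1 / q) :=
          mul_le_mul_of_nonneg_right ha (Real.rpow_nonneg (integral_nonneg fun y => by positivity) _)
      _ ≤ _ := by rw [one_mul]; exact hb

theorem integral_abs_le_of_eLpNorm_le_one {p : ℝ} (hp : 1 ≤ p) {φ : Circ → ℝ}
    (hφ : MemLp φ (ENNReal.ofReal p) volume) (h1 : eLpNorm φ (ENNReal.ofReal p) volume ≤ 1) :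
    ∫ t, |φ t| ≤ 1 + 2 * π := by
  have hp0 : 0 < p := by linarith
  have h := integral_abs_rpow_le_one hp hφ h1
  have hint : Integrable (fun t => |φ t| ^ p) volume := by
    have := hφ.integrable_norm_rpow (by simpa using hp0) ENNReal.ofReal_ne_top
    simpa [ENNReal.toReal_ofReal hp0.le] using this
  have hc : ∫ _ : Circ, (1 : ℝ) = 2 * π := by
    simp [Measure.real, AddCircle.measure_univ, Real.pi_pos.le]
  calc ∫ t, |φ t| ≤ ∫ t, (|φ t| ^ p + 1) := by
        refine integral_mono_of_nonneg (.of_forall fun t => abs_nonneg _)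
          (hint.add (integrable_const _)) (.of_forall fun t => ?_)
        rcases le_total |φ t| 1 with h2 | h2
        · exact h2.trans (le_add_of_nonneg_left (by positivity))
        · exact (Real.self_le_rpow_of_one_le h2 hp).trans (le_add_of_nonneg_right zero_le_one)
    _ = (∫ t, |φ t| ^ p) + 2 * π := by rw [integral_add hint (integrable_const _), hc]
    _ ≤ _ := by linarith

/-! ### The upper bound. -/

theorem fhat_eq_of_isPsiBetaDeriv {ψ : ℕ → ℝ} (hψ : ∀ k, 0 < ψ k) {β : ℝ} {f φ : Circ → ℝ}
    (h : IsPsiBetaDeriv ψ β f φ) {k : ℤ} (hk : k ≠ 0) :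
    fhat f k = ψ k.natAbs * Complex.exp (-(Complex.I * ((β * π / 2 : ℝ) : ℂ) * (k.sign : ℂ)))
      * fhat φ k := by
  have hne : (ψ k.natAbs : ℂ) ≠ 0 := by exact_mod_cast (hψ _).ne'
  rw [h.2.2 k hk, Complex.exp_neg]
  field_simp

theorem norm_exp_phase (θ : ℝ) (s : ℤ) :
    ‖Complex.exp (-(Complex.I * (θ : ℂ) * (s : ℂ)))‖ = 1 := by
  rw [Complex.norm_exp]
  simp

theorem norm_fhat_eq_of_isPsiBetaDeriv {ψ : ℕ → ℝ} (hψ : ∀ k, 0 < ψ k) {β : ℝ} {f φ : Circ → ℝ}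
    (h : IsPsiBetaDeriv ψ β f φ) {k : ℤ} (hk : k ≠ 0) :
    ‖fhat f k‖ = ψ k.natAbs * ‖fhat φ k‖ := by
  rw [fhat_eq_of_isPsiBetaDeriv hψ h hk, norm_mul, norm_mul, norm_exp_phase, mul_one,
    Complex.norm_real, Real.norm_eq_abs, abs_of_pos (hψ _)]

theorem psiExp_zero {α r : ℝ} (hr : 0 < r) : psiExp α r 0 = 1 := by
  simp [psiExp, Real.zero_rpow hr.ne']

theorem summable_psiExp_natAbs {α r : ℝ} (hα : 0 < α) (hr : 0 < r) :
    Summable fun k : ℤ => psiExp α r k.natAbs := by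
  have h : Summable fun j : ℕ => psiExp α r j := by
    simpa using summable_psiExp_add hα hr 0
  exact Summable.of_nat_of_neg (by simpa using h) (by simpa using h)

theorem summable_fhat_of_isPsiBetaDeriv {α r β : ℝ} (hα : 0 < α) (hr : 0 < r) {f φ : Circ → ℝ}
    (h : IsPsiBetaDeriv (psiExp α r) β f φ) : Summable (fhat f) := by
  -- The mean of f is unconstrained by φ; the extra summand ‖fhat f 0‖ covers k = 0, where ψ equals
  -- 1.
  refine .of_norm_bounded ((summable_psiExp_natAbs hα hr).mul_left
    (1 / (2 * π) * (∫ x, |φ x|) + ‖fhat f 0‖)) fun k => ?_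
  have hA : 0 ≤ 1 / (2 * π) * ∫ x, |φ x| := (norm_nonneg _).trans (norm_fhat_le φ 0)
  rcases eq_or_ne k 0 with rfl | hk
  · simpa [psiExp_zero hr] using hA
  · rw [norm_fhat_eq_of_isPsiBetaDeriv (psiExp_pos α r) h hk]
    have h1 := mul_le_mul_of_nonneg_left (norm_fhat_le φ k) (psiExp_pos α r k.natAbs).le
    have h2 := mul_nonneg (norm_nonneg (fhat f 0)) (psiExp_pos α r k.natAbs).le
    linarith

theorem fourier_sub_apply (k : ℤ) (x t : Circ) :
    (fourier k (x - t) : ℂ) = fourier k x * fourier (-k) t := by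
  rw [fourier_apply, fourier_apply, fourier_apply, zsmul_sub, sub_eq_add_neg, neg_smul,
    AddCircle.toCircle_add, Circle.coe_mul]

/-- Sum and integral may be interchanged because `a` is absolutely summable and φ is integrable;
this turns the tail of f into a convolution. -/
theorem tsum_mul_fhat_mul_fourier {φ : Circ → ℝ} (hφ : Integrable φ volume) {a : ℕ → ℝ}
    (ha : Summable a) (κ : ℕ → ℤ) (x : Circ) :
    ∑' j, (a j : ℂ) * fhat φ (κ j) * fourier (κ j) x
      = ∫ t, (φ t : ℂ) * ∑' j, (a j : ℂ) * fourier (κ j) (x - t) ∂AddCircle.haarAddCircle := by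
  have hφ' : Integrable (fun t => (φ t : ℂ)) AddCircle.haarAddCircle :=
    (integrable_haarAddCircle_iff.2 hφ).ofReal
  have hint (j : ℕ) : Integrable (fun t => (φ t : ℂ) * ((a j : ℂ) * fourier (κ j) (x - t)))
      AddCircle.haarAddCircle := by
    refine hφ'.mul_bdd (c := |a j|) (Continuous.aestronglyMeasurable (by fun_prop))
      (.of_forall fun t => ?_)
    rw [norm_mul, norm_fourier_apply, mul_one, Complex.norm_real, Real.norm_eq_abs]
  have h := hasSum_integral_of_summable_integral_norm hint (by
    simp only [norm_mul, norm_fourier_apply, mul_one]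
    simp only [integral_mul_const]
    exact (Complex.ofRealCLM.summable ha).norm.mul_left _)
  have h2 : (fun t => (φ t : ℂ) * ∑' j, (a j : ℂ) * fourier (κ j) (x - t))
      = fun t => ∑' j, (φ t : ℂ) * ((a j : ℂ) * fourier (κ j) (x - t)) := by
    funext t
    rw [tsum_mul_left]
  rw [h2, ← h.tsum_eq]
  refine tsum_congr fun j => ?_
  rw [fhat, fourierCoeff, ← integral_const_mul, ← integral_mul_const]
  refine integral_congr_ae (.of_forall fun t => ?_)
  simp only [smul_eq_mul, fourier_sub_apply]
  ring

theorem exists_ae_norm_sub_partialSum_le {α r p : ℝ} (hα : 0 < α) (hr0 : 0 < r) (hr1 : r < 1)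
    (hp : 1 ≤ p) :
    ∃ C : ℝ, 0 < C ∧ ∀ (β : ℝ) (n : ℕ), 1 ≤ n → ∀ f φ : Circ → ℝ, MemLp f 1 volume →
      IsPsiBetaDeriv (psiExp α r) β f φ → φ ∈ unitBallZero (ENNReal.ofReal p) →
      ∀ᵐ x : Circ, ‖(f x : ℂ) - partialSum (Finset.Ioo (-n : ℤ) n) f x‖ ≤
        C * (psiExp α r n * (n : ℝ) ^ ((1 - r) / p)) := by
  obtain ⟨C₁, hC₁, hker⟩ := exists_norm_tailKernel_le hα hr0 hr1
  obtain ⟨C₂, hC₂, hpk⟩ := exists_integral_abs_mul_peak_le hp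
  have hpi := Real.pi_pos
  refine ⟨2 * ((2 * π)⁻¹ * (C₁ * C₂)), by positivity, fun β n hn f φ hf hd hφ => ?_⟩
  have hn0 : (0 : ℝ) < n := by exact_mod_cast hn
  have hsum := summable_fhat_of_isPsiBetaDeriv hα hr0 hd
  have hφint : Integrable φ volume := memLp_one_iff_integrable.1 hd.1
  have hrep := ae_eq_tsum_fourierCoeff (memLp_one_iff_integrable.1 hf).ofReal hsum
  filter_upwards [hrep] with x hx
  set u : ℤ → ℂ := fun k => fhat f k * fourier k x with hu
  have husum : Summable u := summable_mul_fourier hsum x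
  have hsplit := tsum_int_eq_sum_Ioo_add husum n hn
  have hconj (k : ℤ) : u (-k) = (starRingEnd ℂ) (u k) := by
    simp only [hu, fhat_neg, fourier_neg, map_mul]
  -- Since f is real, the negative tail is the conjugate of the positive one, and only the latter
  -- needs an estimate.
  have hT2 : ∑' j : ℕ, u (-(n + j)) = (starRingEnd ℂ) (∑' j : ℕ, u (n + j)) := by
    rw [Complex.conj_tsum]
    exact tsum_congr fun j => hconj _
  have hdiff : (f x : ℂ) - partialSum (Finset.Ioo (-n : ℤ) n) f x
      = ∑' j : ℕ, u (n + j) + (starRingEnd ℂ) (∑' j : ℕ, u (n + j)) := by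
    have : (f x : ℂ) = ∑' k, u k := hx
    rw [this, hsplit, hT2, partialSum]
    ring
  set θ := β * π / 2
  have hT1 : ∑' j : ℕ, u (n + j) = Complex.exp (-(Complex.I * (θ : ℂ) * ((1 : ℤ) : ℂ))) *
      ∑' j : ℕ, (psiExp α r (n + j) : ℂ) * fhat φ (n + j) * fourier (n + j : ℤ) x := by
    rw [← tsum_mul_left]
    refine tsum_congr fun j => ?_
    have hk : (n + j : ℤ) ≠ 0 := by omega
    have hs : (n + j : ℤ).sign = 1 := Int.sign_eq_one_of_pos (by omega)
    have hna : (n + j : ℤ).natAbs = n + j := by omega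
    simp only [hu]
    rw [fhat_eq_of_isPsiBetaDeriv (psiExp_pos α r) hd hk, hs, hna]
    ring
  have hbound : ‖∑' j : ℕ, u (n + j)‖ ≤
      (2 * π)⁻¹ * (C₁ * C₂) * (psiExp α r n * (n : ℝ) ^ ((1 - r) / p)) := by
    rw [hT1, norm_mul, norm_exp_phase, one_mul,
      tsum_mul_fhat_mul_fourier hφint (summable_psiExp_add hα hr0 n) (fun j => n + j) x]
    have hNpos : 0 < (n : ℝ) ^ (1 - r) := Real.rpow_pos_of_pos hn0 _
    have hpk' := hpk _ hNpos φ hφ.1 hφ.2.1 x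
    rw [← Real.rpow_mul hn0.le, mul_one_div] at hpk'
    set N := (n : ℝ) ^ (1 - r)
    have hwint : Integrable (fun t => |φ t| * (N / (1 + N * ‖x - t‖))) volume := by
      refine hφint.abs.mul_bdd (c := N) (continuous_peak hNpos x).aestronglyMeasurable
        (.of_forall fun t => ?_)
      rw [Real.norm_eq_abs, abs_of_nonneg (by positivity)]
      exact div_le_self hNpos.le (by nlinarith [norm_nonneg (x - t)])
    calc _ ≤ ∫ t, C₁ * psiExp α r n * (|φ t| * (N / (1 + N * ‖x - t‖)))
          ∂AddCircle.haarAddCircle := by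
          refine norm_integral_le_of_norm_le
            ((integrable_haarAddCircle_iff.2 hwint).const_mul _) (.of_forall fun t => ?_)
          rw [norm_mul, Complex.norm_real, Real.norm_eq_abs]
          have := mul_le_mul_of_nonneg_left (hker n hn (x - t)) (abs_nonneg (φ t))
          refine this.trans_eq ?_
          ring
      _ = (2 * π)⁻¹ * (C₁ * psiExp α r n * ∫ t, |φ t| * (N / (1 + N * ‖x - t‖))) := by
          rw [AddCircle.integral_haarAddCircle, integral_const_mul, smul_eq_mul]
      _ ≤ (2 * π)⁻¹ * (C₁ * psiExp α r n * (C₂ * (n : ℝ) ^ ((1 - r) / p))) := by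
          have := psiExp_pos α r n
          gcongr
      _ = _ := by ring
  rw [hdiff]
  refine (norm_add_le _ _).trans ?_
  rw [Complex.norm_conj]
  linarith

theorem exists_orthApproxClass_le {α r p : ℝ} (hα : 0 < α) (hr0 : 0 < r) (hr1 : r < 1)
    (hp : 1 ≤ p) :
    ∃ C : ℝ, 0 < C ∧ ∀ (β : ℝ) (n : ℕ), 1 ≤ n → ∀ m : ℕ, m = 2 * n - 1 ∨ m = 2 * n →
      orthApproxClass m ∞ (classL (psiExp α r) β (ENNReal.ofReal p)) ≤
        ENNReal.ofReal (C * (psiExp α r n * (n : ℝ) ^ ((1 - r) / p))) := by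
  obtain ⟨C, hC, hae⟩ := exists_ae_norm_sub_partialSum_le hα hr0 hr1 hp
  have hpi := Real.pi_pos
  set D := 1 / (2 * π) * (1 + 2 * π)
  have hD : 0 < D := by positivity
  refine ⟨C + D, by positivity, fun β n hn m hm => ?_⟩
  refine iSup₂_le fun f hf => ?_
  obtain ⟨hf1, φ, hd, hφ⟩ := hf
  have hbase := hae β n hn f φ hf1 hd hφ
  have hψ := psiExp_pos α r n
  have hpow : 1 ≤ (n : ℝ) ^ ((1 - r) / p) :=
    one_le_natCast_rpow hn (div_nonneg (by linarith) (by linarith))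
  have hle (γ : Finset ℤ) (hγ : γ.card = m) (h : ∀ᵐ x : Circ, ‖(f x : ℂ) - partialSum γ f x‖ ≤
      (C + D) * (psiExp α r n * (n : ℝ) ^ ((1 - r) / p))) :
      orthApprox m ∞ f ≤ ENNReal.ofReal ((C + D) * (psiExp α r n * (n : ℝ) ^ ((1 - r) / p))) := by
    refine iInf₂_le_of_le γ hγ ?_
    rw [eLpNorm_exponent_top]
    exact eLpNormEssSup_le_of_ae_bound h
  have hcard : (Finset.Ioo (-n : ℤ) n).card = 2 * n - 1 := by
    rw [Int.card_Ioo]; omega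
  have hDψ : psiExp α r n ≤ psiExp α r n * (n : ℝ) ^ ((1 - r) / p) :=
    le_mul_of_one_le_right hψ.le hpow
  rcases hm with rfl | rfl
  · refine hle _ hcard ?_
    filter_upwards [hbase] with x hx
    refine hx.trans ?_
    gcongr
    linarith
  -- Exactly 2n indices are required, so n is added; removing its harmonic costs at most D ψ(n), as
  -- ‖φ‖₁ ≤ 1 + 2π.
  · refine hle (insert (n : ℤ) (Finset.Ioo (-n : ℤ) n)) ?_ ?_
    · rw [Finset.card_insert_of_notMem (by simp), hcard]; omega
    · filter_upwards [hbase] with x hx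
      have hps : partialSum (insert (n : ℤ) (Finset.Ioo (-n : ℤ) n)) f x
          = fhat f n * fourier n x + partialSum (Finset.Ioo (-n : ℤ) n) f x := by
        rw [partialSum, Finset.sum_insert (by simp)]
        rfl
      have hn0 : (n : ℤ) ≠ 0 := by omega
      have hcoef : ‖fhat f n * fourier n x‖ ≤ D * psiExp α r n := by
        rw [norm_mul, norm_fourier_apply, mul_one,
          norm_fhat_eq_of_isPsiBetaDeriv (psiExp_pos α r) hd hn0, Int.natAbs_natCast, mul_comm]
        refine mul_le_mul_of_nonneg_right ((norm_fhat_le φ n).trans ?_) hψ.le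
        exact mul_le_mul_of_nonneg_left (integral_abs_le_of_eLpNorm_le_one hp hφ.1 hφ.2.1)
          (by positivity)
      have hrw : (f x : ℂ) - (fhat f n * fourier n x + partialSum (Finset.Ioo (-n : ℤ) n) f x)
        = ((f x : ℂ) - partialSum (Finset.Ioo (-n : ℤ) n) f x) - fhat f n * fourier n x := by ring
      rw [hps, hrw]
      refine (norm_sub_le _ _).trans ?_
      have := mul_le_mul_of_nonneg_left hDψ hD.le
      linarith

/-! ### Real trigonometric series and the counting argument for the lower bound. -/

/-- The real part of the trigonometric series with coefficients `a`. -/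
def trigSeries (a : ℤ → ℂ) (x : Circ) : ℝ :=
  (∑' k, a k * fourier k x).re

theorem continuous_trigSeries {a : ℤ → ℂ} (ha : Summable a) : Continuous (trigSeries a) :=
  Complex.continuous_re.comp (continuous_tsum_fourier ha)

theorem ofReal_trigSeries {a : ℤ → ℂ} (hconj : ∀ k, a (-k) = (starRingEnd ℂ) (a k)) (x : Circ) :
    (trigSeries a x : ℂ) = ∑' k, a k * fourier k x := by
  refine Complex.conj_eq_iff_re.1 ?_
  rw [Complex.conj_tsum, ← (Equiv.neg ℤ).tsum_eq fun k => a k * fourier k x]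
  refine tsum_congr fun k => ?_
  simp only [Equiv.neg_apply, hconj, fourier_neg, map_mul]

theorem fhat_trigSeries {a : ℤ → ℂ} (ha : Summable a)
    (hconj : ∀ k, a (-k) = (starRingEnd ℂ) (a k)) (k : ℤ) : fhat (trigSeries a) k = a k := by
  unfold fhat
  simp only [ofReal_trigSeries hconj]
  exact fourierCoeff_tsum_fourier ha k

/-- The essential bound holds on a set that is dense (full measure) and closed (continuity), hence
everywhere. -/
theorem ofReal_norm_le_eLpNorm_top {g : Circ → ℂ} (hg : Continuous g) (x : Circ) :
    ENNReal.ofReal ‖g x‖ ≤ eLpNorm g ∞ volume := by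
  rw [eLpNorm_exponent_top, ofReal_norm]
  have hd : Dense {y : Circ | ‖g y‖ₑ ≤ eLpNormEssSup g volume} :=
    Measure.dense_of_ae (enorm_ae_le_eLpNormEssSup g volume)
  have hc : IsClosed {y : Circ | ‖g y‖ₑ ≤ eLpNormEssSup g volume} :=
    isClosed_le hg.enorm continuous_const
  have huniv := hd.closure_eq
  rw [hc.closure_eq] at huniv
  exact huniv.ge (Set.mem_univ x)

/-- At x = 0 every exponential equals 1, so the real part of the residual is the sum of (b k).re
over k outside γ. No term is negative, and at least G.card - m indices of G survive. -/
theorem ofReal_le_orthApprox_trigSeries {b : ℤ → ℂ} (hb : Summable b)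
    (hconj : ∀ k, b (-k) = (starRingEnd ℂ) (b k)) (hre : ∀ k, 0 ≤ (b k).re) {G : Finset ℤ}
    {c : ℝ} (hc : 0 ≤ c) (hG : ∀ k ∈ G, c ≤ (b k).re) (m : ℕ) :
    ENNReal.ofReal (((G.card : ℝ) - m) * c) ≤ orthApprox m ∞ (trigSeries b) := by
  refine le_iInf₂ fun γ hγ => ?_
  have hcont : Continuous fun x : Circ => (trigSeries b x : ℂ) - partialSum γ (trigSeries b) x := by
    refine (Complex.continuous_ofReal.comp (continuous_trigSeries hb)).sub ?_
    unfold partialSum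
    fun_prop
  refine le_trans (ENNReal.ofReal_le_ofReal ?_) (ofReal_norm_le_eLpNorm_top hcont 0)
  refine le_trans ?_ (Complex.re_le_norm _)
  have hb_re : Summable fun k => (b k).re := Complex.reCLM.summable hb
  have h1 : ((trigSeries b 0 : ℂ) - partialSum γ (trigSeries b) 0).re
      = ∑' k, (b k).re - ∑ k ∈ γ, (b k).re := by
    rw [ofReal_trigSeries hconj, partialSum]
    simp only [fourier_eval_zero, mul_one, fhat_trigSeries hb hconj, Complex.sub_re,
      Complex.re_sum, Complex.re_tsum hb]
  have h2 : ∑ k ∈ γ ∪ (G \ γ), (b k).re ≤ ∑' k, (b k).re :=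
    hb_re.sum_le_tsum _ fun k _ => hre k
  rw [Finset.sum_union Finset.disjoint_sdiff] at h2
  have h3 : ((G \ γ).card : ℝ) * c ≤ ∑ k ∈ G \ γ, (b k).re := by
    rw [← nsmul_eq_mul]
    exact Finset.card_nsmul_le_sum _ _ _ fun k hk => hG k (Finset.mem_sdiff.1 hk).1
  have h4 : (G.card : ℝ) - m ≤ (G \ γ).card := by
    have := Finset.le_card_sdiff γ G
    have h5 : G.card ≤ (G \ γ).card + m := by omega
    have h6 : (G.card : ℝ) ≤ (G \ γ).card + m := by exact_mod_cast h5
    linarith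
  rw [h1]
  have := mul_le_mul_of_nonneg_right h4 hc
  linarith

/-! ### The Poisson kernel: positivity, maximum and mean. -/

/-- The Poisson kernel `∑ₖ q^{|k|} e^{ikt}` in closed form. -/
def poissonCirc (q : ℝ) (t : Circ) : ℝ :=
  (1 - q ^ 2) / ‖1 - q * fourier 1 t‖ ^ 2

theorem fourier_natCast (j : ℕ) (y : Circ) : (fourier j y : ℂ) = fourier 1 y ^ j := by
  simpa using fourier_natCast_add 0 j y

theorem hasSum_poissonCirc {q : ℝ} (hq0 : 0 < q) (hq1 : q < 1) (t : Circ) :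
    HasSum (fun k : ℤ => ((q ^ k.natAbs : ℝ) : ℂ) * fourier k t) (poissonCirc q t : ℂ) := by
  set z : ℂ := fourier 1 t with hz
  have hz1 : ‖z‖ = 1 := norm_fourier_apply 1 t
  have hzc : z * (starRingEnd ℂ) z = 1 := by
    rw [Complex.mul_conj, Complex.normSq_eq_norm_sq, hz1]; simp
  have hnorm : ‖(q : ℂ) * z‖ < 1 := by
    rw [norm_mul, hz1, mul_one, Complex.norm_real, Real.norm_eq_abs, abs_of_pos hq0]; exact hq1
  have hnorm' : ‖(q : ℂ) * (starRingEnd ℂ) z‖ < 1 := by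
    rwa [norm_mul, Complex.norm_conj, ← norm_mul]
  have h1 := hasSum_geometric_of_norm_lt_one hnorm
  have h2 := (hasSum_geometric_of_norm_lt_one hnorm').mul_left ((q : ℂ) * (starRingEnd ℂ) z)
  have hpos : HasSum (fun n : ℕ => ((q ^ (n : ℤ).natAbs : ℝ) : ℂ) * fourier (n : ℤ) t)
      (1 - (q : ℂ) * z)⁻¹ := by
    refine h1.congr_fun ?_
    intro n
    simp only [Int.natAbs_natCast, fourier_natCast, mul_pow, Complex.ofReal_pow, ← hz]
  have hneg : HasSum
      (fun n : ℕ => ((q ^ (-((n : ℤ) + 1)).natAbs : ℝ) : ℂ) * fourier (-((n : ℤ) + 1)) t)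
      ((q : ℂ) * (starRingEnd ℂ) z * (1 - (q : ℂ) * (starRingEnd ℂ) z)⁻¹) := by
    refine h2.congr_fun ?_
    intro n
    have hna : (-((n : ℤ) + 1)).natAbs = n + 1 := by omega
    have hcast : (n : ℤ) + 1 = ((n + 1 : ℕ) : ℤ) := by push_cast; ring
    rw [hna, fourier_neg, hcast, fourier_natCast, ← hz, map_pow, mul_pow]
    push_cast
    ring
  have h := HasSum.of_nat_of_neg_add_one
    (f := fun k : ℤ => ((q ^ k.natAbs : ℝ) : ℂ) * fourier k t) hpos hneg
  convert h using 1
  have hne (w : ℂ) (hw : ‖(q : ℂ) * w‖ < 1) : 1 - (q : ℂ) * w ≠ 0 := by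
    intro h0
    rw [sub_eq_zero] at h0
    rw [← h0] at hw
    simp at hw
  have hsq : ((‖1 - (q : ℂ) * z‖ ^ 2 : ℝ) : ℂ)
      = (1 - (q : ℂ) * z) * (1 - (q : ℂ) * (starRingEnd ℂ) z) := by
    rw [← Complex.normSq_eq_norm_sq, ← Complex.mul_conj]
    simp
  unfold poissonCirc
  rw [← hz, Complex.ofReal_div, hsq]
  have hz0 := hne z hnorm
  have hz0' := hne _ hnorm'
  field_simp
  push_cast
  linear_combination (q : ℂ) ^ 2 * hzc

theorem summable_pow_natAbs {q : ℝ} (hq0 : 0 < q) (hq1 : q < 1) :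
    Summable fun k : ℤ => ((q ^ k.natAbs : ℝ) : ℂ) := by
  simpa using (hasSum_poissonCirc hq0 hq1 0).summable

theorem poissonCirc_nonneg {q : ℝ} (hq0 : 0 < q) (hq1 : q < 1) (t : Circ) :
    0 ≤ poissonCirc q t :=
  div_nonneg (by nlinarith) (by positivity)

theorem poissonCirc_add_one_le {q : ℝ} (hq0 : 0 < q) (hq1 : q < 1) (t : Circ) :
    poissonCirc q t + 1 ≤ 2 * (1 / (1 - q)) := by
  have h1 : 1 - q ≤ ‖1 - q * fourier 1 t‖ := by
    have := norm_sub_norm_le (1 : ℂ) (q * fourier 1 t)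
    rwa [norm_one, norm_mul, norm_fourier_apply, mul_one, Complex.norm_real, Real.norm_eq_abs,
      abs_of_pos hq0] at this
  have hpos : 0 < 1 - q := by linarith
  have h2 : poissonCirc q t ≤ (1 - q ^ 2) / (1 - q) ^ 2 :=
    div_le_div_of_nonneg_left (by nlinarith) (by positivity)
      (pow_le_pow_left₀ hpos.le h1 2)
  have h3 : (1 - q ^ 2) / (1 - q) ^ 2 + 1 = 2 * (1 / (1 - q)) := by
    field_simp
    ring
  linarith

theorem continuous_poissonCirc {q : ℝ} (hq0 : 0 < q) (hq1 : q < 1) :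
    Continuous (poissonCirc q) := by
  have h := Complex.continuous_re.comp (continuous_tsum_fourier (summable_pow_natAbs hq0 hq1))
  convert h using 1
  funext t
  simp only [Function.comp]
  rw [(hasSum_poissonCirc hq0 hq1 t).tsum_eq, Complex.ofReal_re]

theorem integral_eq_fhat_zero (f : Circ → ℝ) : ((∫ x, f x : ℝ) : ℂ) = 2 * π * fhat f 0 := by
  unfold fhat fourierCoeff
  simp only [neg_zero, fourier_zero, one_smul]
  rw [AddCircle.integral_haarAddCircle, integral_complex_ofReal, Complex.real_smul]
  have := Real.pi_pos.ne'
  push_cast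
  field_simp

theorem integral_poissonCirc {q : ℝ} (hq0 : 0 < q) (hq1 : q < 1) :
    ∫ t, poissonCirc q t = 2 * π := by
  have h := integral_eq_fhat_zero (poissonCirc q)
  have h1 : fhat (poissonCirc q) 0 = 1 := by
    have h2 := fourierCoeff_tsum_fourier (summable_pow_natAbs hq0 hq1) 0
    simp only [(hasSum_poissonCirc hq0 hq1 _).tsum_eq] at h2
    simpa [fhat] using h2
  rw [h1, mul_one] at h
  exact_mod_cast h

/-- Interpolation between L₁ and L_∞ through |φ|^p ≤ S^(p-1) |φ|. -/
theorem eLpNorm_le_of_abs_le {p : ℝ} (hp : 1 ≤ p) {φ : Circ → ℝ} {S A : ℝ} (hφ : Continuous φ)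
    (hS : ∀ t, |φ t| ≤ S) (hA : ∫ t, |φ t| ≤ A) :
    eLpNorm φ (ENNReal.ofReal p) volume ≤ ENNReal.ofReal ((S ^ (p - 1) * A) ^ (1 / p)) := by
  have hp0 : 0 < p := by linarith
  have hmem : MemLp φ (ENNReal.ofReal p) volume :=
    hφ.memLp_of_hasCompactSupport (.of_compactSpace _)
  have hint : Integrable φ volume := hφ.integrable_of_hasCompactSupport (.of_compactSpace _)
  have hS0 : 0 ≤ S := (abs_nonneg _).trans (hS 0)
  rw [hmem.eLpNorm_eq_integral_rpow_norm (by simpa using hp0) ENNReal.ofReal_ne_top,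
    ENNReal.toReal_ofReal hp0.le, one_div]
  refine ENNReal.ofReal_le_ofReal (Real.rpow_le_rpow
    (integral_nonneg fun t => by positivity) ?_ (by positivity))
  calc ∫ t, ‖φ t‖ ^ p ≤ ∫ t, S ^ (p - 1) * |φ t| := by
        refine integral_mono_of_nonneg (.of_forall fun t => by positivity)
          (hint.abs.const_mul _) (.of_forall fun t => ?_)
        simp only [Real.norm_eq_abs]
        rcases (abs_nonneg (φ t)).eq_or_lt with h0 | h0
        · rw [← h0, Real.zero_rpow hp0.ne', mul_zero]
        · have : |φ t| ^ p = |φ t| ^ (p - 1) * |φ t| := by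
            rw [← Real.rpow_add_one h0.ne', sub_add_cancel]
          rw [this]
          exact mul_le_mul_of_nonneg_right
            (Real.rpow_le_rpow h0.le (hS t) (by linarith)) h0.le
    _ = S ^ (p - 1) * ∫ t, |φ t| := integral_const_mul _ _
    _ ≤ _ := mul_le_mul_of_nonneg_left hA (Real.rpow_nonneg hS0 _)

/-! ### The extremal function: a modulated Poisson kernel and its (ψ, β)-integral. -/

/-- The Fourier coefficients of `t ↦ cos (M t + θ) P_q(t)` with its mean removed, where `P_q` is
the Poisson kernel. -/
def modulatedCoeff (q θ : ℝ) (M : ℕ) (k : ℤ) : ℂ :=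
  if k = 0 then 0 else
    (Complex.exp (Complex.I * θ) * ((q ^ (k - M).natAbs : ℝ) : ℂ)
      + Complex.exp (-(Complex.I * θ)) * ((q ^ (k + M).natAbs : ℝ) : ℂ)) / 2

theorem conj_exp_I_mul (θ : ℝ) :
    (starRingEnd ℂ) (Complex.exp (Complex.I * θ)) = Complex.exp (-(Complex.I * θ)) := by
  rw [← Complex.exp_conj]
  simp

theorem modulatedCoeff_neg (q θ : ℝ) (M : ℕ) (k : ℤ) :
    modulatedCoeff q θ M (-k) = (starRingEnd ℂ) (modulatedCoeff q θ M k) := by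
  unfold modulatedCoeff
  by_cases hk : k = 0
  · simp [hk]
  · have h1 : (-k - M).natAbs = (k + M).natAbs := by omega
    have h2 : (-k + M).natAbs = (k - M).natAbs := by omega
    have h3 : (starRingEnd ℂ) (Complex.exp (-(Complex.I * θ))) = Complex.exp (Complex.I * θ) := by
      rw [← conj_exp_I_mul, Complex.conj_conj]
    simp only [hk, neg_eq_zero, if_false, h1, h2, map_div₀, map_add, map_mul, conj_exp_I_mul, h3,
      Complex.conj_ofReal, map_ofNat]
    rw [add_comm]

theorem hasSum_modulatedCoeff {q : ℝ} (hq0 : 0 < q) (hq1 : q < 1) (θ : ℝ) (M : ℕ) (t : Circ) :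
    HasSum (fun k => modulatedCoeff q θ M k * fourier k t)
      ((Complex.exp (Complex.I * θ) * (fourier M t * poissonCirc q t)
        + Complex.exp (-(Complex.I * θ)) * (fourier (-M) t * poissonCirc q t)) / 2
        - (Complex.exp (Complex.I * θ) + Complex.exp (-(Complex.I * θ))) * ((q ^ M : ℝ) : ℂ) / 2) := by
  have hP := hasSum_poissonCirc hq0 hq1 t
  have hshift (m : ℤ) : HasSum (fun k : ℤ => ((q ^ (k - m).natAbs : ℝ) : ℂ) * fourier k t)
      (fourier m t * poissonCirc q t) := by
    have h := ((Equiv.subRight m).hasSum_iff.2 hP).mul_left (fourier m t : ℂ)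
    refine h.congr_fun fun k => ?_
    simp only [Function.comp, Equiv.subRight_apply]
    have : (fourier k t : ℂ) = fourier m t * fourier (k - m) t := by
      rw [← fourier_add]; congr 2; ring
    rw [this]; ring
  have h1 := (hshift M).mul_left (Complex.exp (Complex.I * θ))
  have h2 := (hshift (-M)).mul_left (Complex.exp (-(Complex.I * θ)))
  have h3 := hasSum_ite_eq (0 : ℤ)
    ((Complex.exp (Complex.I * θ) + Complex.exp (-(Complex.I * θ))) * ((q ^ M : ℝ) : ℂ) / 2)
  refine (((h1.add h2).div_const 2).sub h3).congr_fun fun k => ?_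
  unfold modulatedCoeff
  by_cases hk : k = 0
  · subst hk
    simp
    ring
  · simp only [hk, if_false, sub_neg_eq_add, sub_zero]
    ring

theorem summable_modulatedCoeff {q : ℝ} (hq0 : 0 < q) (hq1 : q < 1) (θ : ℝ) (M : ℕ) :
    Summable (modulatedCoeff q θ M) := by
  simpa using (hasSum_modulatedCoeff hq0 hq1 θ M 0).summable

theorem norm_exp_I_mul (θ : ℝ) : ‖Complex.exp (Complex.I * θ)‖ = 1 := by
  rw [mul_comm]
  exact Complex.norm_exp_ofReal_mul_I θ

theorem abs_trigSeries_modulatedCoeff_le {q : ℝ} (hq0 : 0 < q) (hq1 : q < 1) (θ : ℝ) (M : ℕ)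
    (t : Circ) : |trigSeries (modulatedCoeff q θ M) t| ≤ poissonCirc q t + 1 := by
  have h1 : |trigSeries (modulatedCoeff q θ M) t| ≤ ‖∑' k, modulatedCoeff q θ M k * fourier k t‖ :=
    Complex.abs_re_le_norm _
  refine h1.trans ?_
  rw [(hasSum_modulatedCoeff hq0 hq1 θ M t).tsum_eq]
  have hE := norm_exp_I_mul θ
  have hE' : ‖Complex.exp (-(Complex.I * θ))‖ = 1 := by
    rw [← conj_exp_I_mul, Complex.norm_conj, hE]
  have hP := poissonCirc_nonneg hq0 hq1 t
  have hq : q ^ M ≤ 1 := pow_le_one₀ hq0.le hq1.le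
  refine (norm_sub_le _ _).trans (add_le_add ?_ ?_)
  · rw [norm_div, Complex.norm_two, div_le_iff₀ two_pos]
    refine (norm_add_le _ _).trans ?_
    simp only [norm_mul, hE, hE', norm_fourier_apply, Complex.norm_real, Real.norm_eq_abs,
      abs_of_nonneg hP]
    linarith
  · rw [norm_div, Complex.norm_two, div_le_iff₀ two_pos, norm_mul, Complex.norm_real,
      Real.norm_eq_abs, abs_of_nonneg (by positivity)]
    have := norm_add_le (Complex.exp (Complex.I * θ)) (Complex.exp (-(Complex.I * θ)))
    rw [hE, hE'] at this
    nlinarith [norm_nonneg (Complex.exp (Complex.I * θ) + Complex.exp (-(Complex.I * θ))),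
      pow_pos hq0 M]

theorem eLpNorm_trigSeries_modulatedCoeff_le {p q : ℝ} (hp : 1 ≤ p) (hq0 : 0 < q) (hq1 : q < 1)
    (θ : ℝ) (M : ℕ) :
    eLpNorm (trigSeries (modulatedCoeff q θ M)) (ENNReal.ofReal p) volume ≤
      ENNReal.ofReal (((2 * (1 / (1 - q))) ^ (p - 1) * (4 * π)) ^ (1 / p)) := by
  have hle := abs_trigSeries_modulatedCoeff_le hq0 hq1 θ M
  refine eLpNorm_le_of_abs_le hp (continuous_trigSeries (summable_modulatedCoeff hq0 hq1 θ M))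
    (fun t => (hle t).trans (poissonCirc_add_one_le hq0 hq1 t)) ?_
  have hP : Integrable (poissonCirc q) volume :=
    (continuous_poissonCirc hq0 hq1).integrable_of_hasCompactSupport (.of_compactSpace _)
  have hc : ∫ _ : Circ, (1 : ℝ) = 2 * π := by
    simp [Measure.real, AddCircle.measure_univ, Real.pi_pos.le]
  calc ∫ t, |trigSeries (modulatedCoeff q θ M) t| ≤ ∫ t, (poissonCirc q t + 1) :=
        integral_mono_of_nonneg (.of_forall fun t => abs_nonneg _)
          (hP.add (integrable_const _)) (.of_forall hle)
    _ = 4 * π := by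
        rw [integral_add hP (integrable_const _), hc, integral_poissonCirc hq0 hq1]
        ring

/-- The Fourier coefficients of the `(ψ, β)`-integral of the series with coefficients `a`, where
`θ = β π / 2`. -/
def integratedCoeff (ψ : ℕ → ℝ) (θ : ℝ) (a : ℤ → ℂ) (k : ℤ) : ℂ :=
  ψ k.natAbs * Complex.exp (-(Complex.I * (θ : ℂ) * (k.sign : ℂ))) * a k

theorem integratedCoeff_neg (ψ : ℕ → ℝ) (θ : ℝ) {a : ℤ → ℂ}
    (hconj : ∀ k, a (-k) = (starRingEnd ℂ) (a k)) (k : ℤ) :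
    integratedCoeff ψ θ a (-k) = (starRingEnd ℂ) (integratedCoeff ψ θ a k) := by
  simp [integratedCoeff, hconj, ← Complex.exp_conj]

theorem summable_integratedCoeff {ψ : ℕ → ℝ} (hψ : ∀ k, 0 < ψ k) (hψ1 : ∀ k, ψ k ≤ 1) (θ : ℝ)
    {a : ℤ → ℂ} (ha : Summable a) : Summable (integratedCoeff ψ θ a) := by
  refine .of_norm_bounded ha.norm fun k => ?_
  rw [integratedCoeff, norm_mul, norm_mul, norm_exp_phase, mul_one, Complex.norm_real,
    Real.norm_eq_abs, abs_of_pos (hψ _)]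
  exact mul_le_of_le_one_left (norm_nonneg _) (hψ1 _)

theorem trigSeries_integratedCoeff_mem_classL {ψ : ℕ → ℝ} (hψ : ∀ k, 0 < ψ k)
    (hψ1 : ∀ k, ψ k ≤ 1) (β : ℝ) {p : ℝ} {a : ℤ → ℂ} (ha : Summable a)
    (hconj : ∀ k, a (-k) = (starRingEnd ℂ) (a k)) (h0 : a 0 = 0)
    (hnorm : eLpNorm (trigSeries a) (ENNReal.ofReal p) volume ≤ 1) :
    trigSeries (integratedCoeff ψ (β * π / 2) a) ∈ classL ψ β (ENNReal.ofReal p) := by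
  have hb := summable_integratedCoeff hψ hψ1 (β * π / 2) ha
  have hbconj := integratedCoeff_neg ψ (β * π / 2) hconj
  have hLp (a : ℤ → ℂ) (ha : Summable a) (s : ℝ≥0∞) : MemLp (trigSeries a) s volume :=
    (continuous_trigSeries ha).memLp_of_hasCompactSupport (.of_compactSpace _)
  refine ⟨hLp _ hb 1, trigSeries a, ⟨hLp _ ha 1, ?_, fun k hk => ?_⟩, hLp _ ha _, hnorm, ?_⟩
  · rw [fhat_trigSeries ha hconj, h0]
  · have hne : (ψ k.natAbs : ℂ) ≠ 0 := by exact_mod_cast (hψ _).ne'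
    rw [fhat_trigSeries ha hconj, fhat_trigSeries hb hbconj, integratedCoeff, Complex.exp_neg]
    field_simp
  · have h := integral_eq_fhat_zero (trigSeries a)
    rw [fhat_trigSeries ha hconj, h0, mul_zero] at h
    exact_mod_cast h

theorem trigSeries_const_mul (c : ℝ) (a : ℤ → ℂ) :
    trigSeries (fun k => (c : ℂ) * a k) = c • trigSeries a := by
  funext x
  simp only [trigSeries, mul_assoc, tsum_mul_left, Complex.re_ofReal_mul, Pi.smul_apply,
    smul_eq_mul]

/-- For k > 0 the β-rotation cancels the phase of the bump at M exactly; the bump at -M keeps the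
phase e^{-2iθ} and costs at most its modulus. -/
theorem le_re_exp_mul_modulatedCoeff {q : ℝ} (hq0 : 0 < q) (θ : ℝ) (M k : ℕ) (hk : 1 ≤ k) :
    (q ^ ((k : ℤ) - M).natAbs - q ^ (k + M)) / 2 ≤
      (Complex.exp (-(Complex.I * (θ : ℂ) * (((k : ℤ).sign : ℤ) : ℂ)))
        * modulatedCoeff q θ M k).re := by
  have hk0 : (k : ℤ) ≠ 0 := by omega
  have hs : (k : ℤ).sign = 1 := Int.sign_eq_one_of_pos (by omega)
  have hna : ((k : ℤ) + M).natAbs = k + M := by omega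
  have hmul : Complex.exp (-(Complex.I * θ)) * Complex.exp (Complex.I * θ) = 1 := by
    rw [← Complex.exp_add]; simp
  have heq : Complex.exp (-(Complex.I * (θ : ℂ) * (((k : ℤ).sign : ℤ) : ℂ)))
      * modulatedCoeff q θ M k = ((q ^ ((k : ℤ) - M).natAbs / 2 : ℝ) : ℂ)
        + ((q ^ (k + M) / 2 : ℝ) : ℂ) * Complex.exp (-(Complex.I * θ)) ^ 2 := by
    rw [modulatedCoeff, if_neg hk0, hs, hna]
    push_cast
    rw [mul_one]
    linear_combination (((q : ℂ) ^ ((k : ℤ) - M).natAbs) / 2) * hmul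
  have hn : ‖Complex.exp (-(Complex.I * θ)) ^ 2‖ = 1 := by
    rw [norm_pow, ← conj_exp_I_mul, Complex.norm_conj, norm_exp_I_mul, one_pow]
  have hre : -1 ≤ (Complex.exp (-(Complex.I * θ)) ^ 2).re := by
    have := Complex.abs_re_le_norm (Complex.exp (-(Complex.I * θ)) ^ 2)
    rw [hn] at this
    exact (abs_le.1 this).1
  rw [heq, Complex.add_re, Complex.ofReal_re, Complex.re_ofReal_mul]
  have : 0 < q ^ (k + M) / 2 := by positivity
  nlinarith

theorem le_re_integratedCoeff_modulatedCoeff {ψ : ℕ → ℝ} (hψ : ∀ k, 0 < ψ k) {c q : ℝ}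
    (hc : 0 ≤ c) (hq0 : 0 < q) (θ : ℝ) (M : ℕ) (k : ℤ) (hk : k ≠ 0) :
    c * (ψ k.natAbs * ((q ^ ((k.natAbs : ℤ) - M).natAbs - q ^ (k.natAbs + M)) / 2)) ≤
      (integratedCoeff ψ θ (fun k => (c : ℂ) * modulatedCoeff q θ M k) k).re := by
  have hcase (k : ℕ) (hk : 1 ≤ k) :
      c * (ψ k * ((q ^ ((k : ℤ) - M).natAbs - q ^ (k + M)) / 2)) ≤
        (integratedCoeff ψ θ (fun k => (c : ℂ) * modulatedCoeff q θ M k) k).re := by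
    have h := le_re_exp_mul_modulatedCoeff hq0 θ M k hk
    have h2 := mul_le_mul_of_nonneg_left (mul_le_mul_of_nonneg_left h (hψ k).le) hc
    refine h2.trans_eq ?_
    rw [← Complex.re_ofReal_mul, ← Complex.re_ofReal_mul, integratedCoeff, Int.natAbs_natCast]
    congr 1
    ring
  have h := hcase k.natAbs (by omega)
  rcases Int.natAbs_eq k with h1 | h1
  · rw [← h1] at h ⊢
    exact h
  · rw [h1, integratedCoeff_neg, Complex.conj_re, Int.natAbs_neg, Int.natAbs_natCast]
    · exact h
    · intro j
      simp only [modulatedCoeff_neg, map_mul, Complex.conj_ofReal]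

theorem re_integratedCoeff_modulatedCoeff_nonneg {ψ : ℕ → ℝ} (hψ : ∀ k, 0 < ψ k) {c q : ℝ}
    (hc : 0 ≤ c) (hq0 : 0 < q) (hq1 : q < 1) (θ : ℝ) (M : ℕ) (k : ℤ) :
    0 ≤ (integratedCoeff ψ θ (fun k => (c : ℂ) * modulatedCoeff q θ M k) k).re := by
  rcases eq_or_ne k 0 with rfl | hk
  · simp [integratedCoeff, modulatedCoeff]
  · refine le_trans ?_ (le_re_integratedCoeff_modulatedCoeff hψ hc hq0 θ M k hk)
    have : q ^ (k.natAbs + M) ≤ q ^ ((k.natAbs : ℤ) - M).natAbs :=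
      pow_le_pow_of_le_one hq0.le hq1.le (by omega)
    have := hψ k.natAbs
    exact mul_nonneg hc (mul_nonneg this.le (by linarith))

/-! ### Choice of parameters and the lower bound. -/

theorem psiExp_le_one {α r : ℝ} (hα : 0 < α) (k : ℕ) : psiExp α r k ≤ 1 := by
  refine Real.exp_le_one_iff.2 ?_
  have : 0 ≤ (k : ℝ) ^ r := Real.rpow_nonneg (Nat.cast_nonneg k) r
  nlinarith

/-- With log q equal to the slope of log ψ at n, convexity of log ψ makes ψ(k) q^(M-k) minimal at k
= n. So the bound holds on both sides of n. -/
theorem psiExp_mul_exp_le {α r : ℝ} (hα : 0 < α) (hr0 : 0 < r) (hr1 : r < 1) {n : ℕ} (hn : 1 ≤ n)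
    (k : ℕ) (M : ℝ) :
    psiExp α r n * Real.exp (-(α * r * (n : ℝ) ^ (r - 1) * (M - n))) ≤
      psiExp α r k * Real.exp (-(α * r * (n : ℝ) ^ (r - 1) * (M - k))) := by
  unfold psiExp
  rw [← Real.exp_add, ← Real.exp_add]
  refine Real.exp_le_exp.2 ?_
  have h := rpow_le_tangent hr0.le hr1.le (x := (n : ℝ)) (y := k) (by exact_mod_cast hn)
    (Nat.cast_nonneg k)
  nlinarith

theorem eLpNorm_scaled_trigSeries_modulatedCoeff_le_one {p y N : ℝ} (hp : 1 ≤ p) (hypos : 0 < y)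
    (hN1 : 1 ≤ N) (θ : ℝ) (M : ℕ) :
    eLpNorm (trigSeries fun k =>
      (((((2 * (1 + 1 / y)) ^ (p - 1) * (4 * π)) ^ (1 / p) * N ^ (1 - 1 / p))⁻¹ : ℝ) : ℂ)
        * modulatedCoeff (Real.exp (-(y * N⁻¹))) θ M k) (ENNReal.ofReal p) volume ≤ 1 := by
  have hpi := Real.pi_pos
  have hp0 : 0 < p := by linarith
  have hN0 : 0 < N := by linarith
  set C₃ := 2 * (1 + 1 / y) with hC₃
  have hC₃pos : 0 < C₃ := by positivity
  set C₄ := (C₃ ^ (p - 1) * (4 * π)) ^ (1 / p)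
  have hC₄pos : 0 < C₄ := by positivity
  set x := y * N⁻¹ with hx
  have hxpos : 0 < x := by positivity
  set q := Real.exp (-x) with hq
  have hq0 : 0 < q := Real.exp_pos _
  have hq1 : q < 1 := by rw [hq, ← Real.exp_zero]; exact Real.exp_lt_exp.2 (by linarith)
  set B := C₄ * N ^ (1 - 1 / p) with hB
  have hBpos : 0 < B := mul_pos hC₄pos (Real.rpow_pos_of_pos hN0 _)
  -- 1 / (1 - q) ≤ 1 + N / y, and N ≥ 1 absorbs the 1.
  have h1 : 2 * (1 / (1 - q)) ≤ C₃ * N := by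
    have h2 := one_div_one_sub_exp_neg_le hxpos
    have h3 : 1 / x = 1 / y * N := by rw [hx]; field_simp
    rw [h3] at h2
    rw [hC₃]
    nlinarith
  have h0 : 0 ≤ 2 * (1 / (1 - q)) := by
    have : 0 < 1 - q := by linarith
    positivity
  have h4 : ((2 * (1 / (1 - q))) ^ (p - 1) * (4 * π)) ^ (1 / p) ≤ B := by
    calc ((2 * (1 / (1 - q))) ^ (p - 1) * (4 * π)) ^ (1 / p)
        ≤ ((C₃ * N) ^ (p - 1) * (4 * π)) ^ (1 / p) := by
          refine Real.rpow_le_rpow (by positivity) ?_ (by positivity)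
          exact mul_le_mul_of_nonneg_right (Real.rpow_le_rpow h0 h1 (by linarith))
            (by positivity)
      _ = ((C₃ ^ (p - 1) * (4 * π)) * N ^ (p - 1)) ^ (1 / p) := by
          rw [Real.mul_rpow hC₃pos.le hN0.le]; congr 1; ring
      _ = C₄ * (N ^ (p - 1)) ^ (1 / p) := Real.mul_rpow (by positivity) (by positivity)
      _ = B := by
          rw [hB, ← Real.rpow_mul hN0.le]
          congr 2
          field_simp
  rw [trigSeries_const_mul, eLpNorm_const_smul, Real.enorm_eq_ofReal (by positivity)]
  calc _ ≤ ENNReal.ofReal B⁻¹ * ENNReal.ofReal B := by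
        gcongr
        exact (eLpNorm_trigSeries_modulatedCoeff_le hp hq0 hq1 θ M).trans
          (ENNReal.ofReal_le_ofReal h4)
    _ = 1 := by
        rw [← ENNReal.ofReal_mul (by positivity), inv_mul_cancel₀ hBpos.ne', ENNReal.ofReal_one]

theorem le_psiExp_mul_sub_pow_div_two {α r D : ℝ} (hα : 0 < α) (hr0 : 0 < r) (hr1 : r < 1)
    {n j M : ℕ} (hn : 1 ≤ n) (hjM : j ≤ M) (hj : 1 / 2 ≤ α * r * ((n : ℝ) ^ (1 - r))⁻¹ * j)
    (hM : α * r * ((n : ℝ) ^ (1 - r))⁻¹ * ((M : ℝ) - n) ≤ D) :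
    psiExp α r n * Real.exp (-D) / 4 ≤
      psiExp α r j * ((Real.exp (-(α * r * ((n : ℝ) ^ (1 - r))⁻¹)) ^ ((j : ℤ) - M).natAbs
        - Real.exp (-(α * r * ((n : ℝ) ^ (1 - r))⁻¹)) ^ (j + M)) / 2) := by
  have hxN : (n : ℝ) ^ (r - 1) = ((n : ℝ) ^ (1 - r))⁻¹ := by
    rw [← Real.rpow_neg (Nat.cast_nonneg n)]; congr 1; ring
  have htan := psiExp_mul_exp_le hα hr0 hr1 hn j M
  rw [hxN] at htan
  set x := α * r * ((n : ℝ) ^ (1 - r))⁻¹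
  set q := Real.exp (-x) with hq
  have hq0 : 0 < q := Real.exp_pos _
  have hqpow (j : ℕ) : q ^ j = Real.exp (-(x * j)) := by
    rw [hq, ← Real.exp_nat_mul]; congr 1; ring
  have hna : ((j : ℤ) - M).natAbs = M - j := by omega
  have hjM' : (j : ℝ) ≤ M := by exact_mod_cast hjM
  rw [hna]
  have h1 : q ^ (j + M) = q ^ (M - j) * q ^ (2 * j) := by
    rw [← pow_add]; congr 1; omega
  -- Here x j ≥ 1/2 gives q^(2j) ≤ e⁻¹, so the bump at -M costs at most half of the main term.
  have h2 : q ^ (2 * j) ≤ 1 / 2 := by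
    rw [hqpow]
    have h3 : 1 ≤ x * ((2 * j : ℕ) : ℝ) := by push_cast; nlinarith
    have h4 : Real.exp (-(x * ((2 * j : ℕ) : ℝ))) ≤ Real.exp (-1) :=
      Real.exp_le_exp.2 (by linarith)
    have h5 : Real.exp (-1) ≤ 1 / 2 := by
      rw [Real.exp_neg, ← one_div]
      exact one_div_le_one_div_of_le two_pos (by linarith [Real.add_one_le_exp (1 : ℝ)])
    linarith
  have h6 : psiExp α r n * Real.exp (-D) ≤ psiExp α r j * q ^ (M - j) := by
    rw [hqpow, Nat.cast_sub hjM]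
    refine le_trans ?_ htan
    exact mul_le_mul_of_nonneg_left (Real.exp_le_exp.2 (by linarith)) (psiExp_pos α r n).le
  have h7 : 0 < psiExp α r j * q ^ (M - j) := mul_pos (psiExp_pos α r j) (pow_pos hq0 _)
  rw [h1]
  nlinarith

theorem card_Icc_union_Icc_neg {a b : ℕ} (ha : 1 ≤ a) (hab : a ≤ b) :
    (Finset.Icc (a : ℤ) b ∪ Finset.Icc (-b : ℤ) (-a)).card = 2 * (b - a + 1) := by
  rw [Finset.card_union_of_disjoint, Int.card_Icc, Int.card_Icc]
  · omega
  · rw [Finset.disjoint_left]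
    intro k
    simp only [Finset.mem_Icc]
    omega

theorem exists_le_orthApproxClass {α r p : ℝ} (hα : 0 < α) (hr0 : 0 < r) (hr1 : r < 1)
    (hp : 1 ≤ p) :
    ∃ c : ℝ, 0 < c ∧ ∀ (β : ℝ) (n : ℕ), 1 ≤ n → ∀ m : ℕ, m ≤ 2 * n →
      ENNReal.ofReal (c * (psiExp α r n * (n : ℝ) ^ ((1 - r) / p))) ≤
        orthApproxClass m ∞ (classL (psiExp α r) β (ENNReal.ofReal p)) := by
  have hpi := Real.pi_pos
  have hp0 : 0 < p := by linarith
  set y := α * r with hy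
  have hypos : 0 < y := by positivity
  set C₃ := 2 * (1 + 1 / y) with hC₃
  have hC₃pos : 0 < C₃ := by positivity
  set C₄ := (C₃ ^ (p - 1) * (4 * π)) ^ (1 / p) with hC₄
  have hC₄pos : 0 < C₄ := by positivity
  set c₀ := Real.exp (-(1 / 2 + 3 * y)) with hc₀
  have hc₀pos : 0 < c₀ := Real.exp_pos _
  refine ⟨c₀ / (2 * C₄), by positivity, fun β n hn m hm => ?_⟩
  have hn0 : (0 : ℝ) < n := by exact_mod_cast hn
  have hN1 : 1 ≤ (n : ℝ) ^ (1 - r) := one_le_natCast_rpow hn (by linarith)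
  have hNp : (n : ℝ) ^ ((1 - r) / p) = ((n : ℝ) ^ (1 - r)) ^ (1 / p) := by
    rw [← Real.rpow_mul hn0.le, mul_one_div]
  rw [hNp]
  set N := (n : ℝ) ^ (1 - r)
  have hN0 : 0 < N := by linarith
  set x := y * N⁻¹ with hx
  have hxpos : 0 < x := by positivity
  have hxN1 : x * N = y := by rw [hx]; field_simp
  set q := Real.exp (-x) with hq
  have hq0 : 0 < q := Real.exp_pos _
  have hq1 : q < 1 := by rw [hq, ← Real.exp_zero]; exact Real.exp_lt_exp.2 (by linarith)
  -- K starts where the bump at -M is harmless (x K ≥ 1/2), and L ≥ N is the surplus of indices.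
  -- With M = n + K + L, the range K ≤ |k| ≤ M has 2(n + L + 1) indices, while x (M - n) ≤ 1/2 + 3y
  -- keeps q^(M-n) at least c₀.
  set K := ⌈1 / (2 * x)⌉₊ with hK
  set L := ⌈N⌉₊ with hL
  set M := n + K + L with hM
  have hK1 : 1 ≤ K := Nat.ceil_pos.2 (by positivity)
  have hKle : 1 / (2 * x) ≤ K := Nat.le_ceil _
  have hKlt : (K : ℝ) < 1 / (2 * x) + 1 := Nat.ceil_lt_add_one (by positivity)
  have hLle : N ≤ L := Nat.le_ceil _
  have hLlt : (L : ℝ) < N + 1 := Nat.ceil_lt_add_one hN0.le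
  have hxy : x ≤ y := by nlinarith
  have hxK : 1 / 2 ≤ x * K := by
    have := mul_le_mul_of_nonneg_left hKle hxpos.le
    have h2 : x * (1 / (2 * x)) = 1 / 2 := by field_simp
    linarith
  have hxM : x * ((M : ℝ) - n) ≤ 1 / 2 + 3 * y := by
    have h1 : (M : ℝ) - n = K + L := by rw [hM]; push_cast; ring
    have h2 : x * (1 / (2 * x)) = 1 / 2 := by field_simp
    have h3 := mul_le_mul_of_nonneg_left hKlt.le hxpos.le
    have h4 := mul_le_mul_of_nonneg_left hLlt.le hxpos.le
    rw [h1]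
    linarith
  set B := C₄ * N ^ (1 - 1 / p) with hB
  have hBpos : 0 < B := mul_pos hC₄pos (Real.rpow_pos_of_pos hN0 _)
  set θ := β * π / 2 with hθ
  set a : ℤ → ℂ := fun k => ((B⁻¹ : ℝ) : ℂ) * modulatedCoeff q θ M k with ha
  have hasum : Summable a := (summable_modulatedCoeff hq0 hq1 θ M).mul_left _
  have haconj (k : ℤ) : a (-k) = (starRingEnd ℂ) (a k) := by
    simp only [ha, modulatedCoeff_neg, map_mul, Complex.conj_ofReal]
  have hnorm : eLpNorm (trigSeries a) (ENNReal.ofReal p) volume ≤ 1 :=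
    eLpNorm_scaled_trigSeries_modulatedCoeff_le_one hp hypos hN1 θ M
  have ha0 : a 0 = 0 := by simp [ha, modulatedCoeff]
  have hψ := psiExp_pos α r
  have hψ1 := psiExp_le_one (r := r) hα
  have hmem := trigSeries_integratedCoeff_mem_classL hψ hψ1 β hasum haconj ha0 hnorm
  refine le_trans ?_ (le_iSup₂_of_le _ hmem le_rfl)
  set G := Finset.Icc (K : ℤ) M ∪ Finset.Icc (-M : ℤ) (-K) with hG
  have hKM : K ≤ M := by omega
  have hcard : G.card = 2 * (M - K + 1) := card_Icc_union_Icc_neg hK1 hKM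
  have hlow := ofReal_le_orthApprox_trigSeries (G := G)
    (c := B⁻¹ * (psiExp α r n * c₀ / 4))
    (summable_integratedCoeff hψ hψ1 θ hasum) (integratedCoeff_neg _ θ haconj)
    (fun k => re_integratedCoeff_modulatedCoeff_nonneg hψ (by positivity) hq0 hq1 θ M k)
    (by have := hψ n; positivity) (fun k hk => ?_) m
  · refine le_trans (ENNReal.ofReal_le_ofReal ?_) hlow
    have h1 : 2 * N ≤ (G.card : ℝ) - m := by
      have h2 : 2 * L + m ≤ G.card := by omega
      have h3 : 2 * (L : ℝ) + m ≤ G.card := by exact_mod_cast h2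
      linarith
    -- N surviving coefficients against the normalisation N^(1-1/p) leave the power N^(1/p).
    have h4 : N / B = N ^ (1 / p) / C₄ := by
      have h5 : N = N ^ (1 / p) * N ^ (1 - 1 / p) := by
        rw [← Real.rpow_add hN0]; simp
      rw [hB, div_eq_div_iff (by positivity) hC₄pos.ne']
      nth_rewrite 1 [h5]
      ring
    calc c₀ / (2 * C₄) * (psiExp α r n * N ^ (1 / p))
        = c₀ / 2 * psiExp α r n * (N ^ (1 / p) / C₄) := by field_simp
      _ = 2 * N * (B⁻¹ * (psiExp α r n * c₀ / 4)) := by rw [← h4]; field_simp; ring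
      _ ≤ _ := by
        have := hψ n
        exact mul_le_mul_of_nonneg_right h1 (by positivity)
  · have hrange : K ≤ k.natAbs ∧ k.natAbs ≤ M := by
      simp only [hG, Finset.mem_union, Finset.mem_Icc] at hk
      omega
    have hk0 : k ≠ 0 := by rintro rfl; simp at hrange; omega
    refine le_trans ?_ (le_re_integratedCoeff_modulatedCoeff hψ (by positivity) hq0 θ M k hk0)
    refine mul_le_mul_of_nonneg_left ?_ (by positivity)
    exact le_psiExp_mul_sub_pow_div_two hα hr0 hr1 hn hrange.2
      (hxK.trans (mul_le_mul_of_nonneg_left (by exact_mod_cast hrange.1) hxpos.le)) hxM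

end

theorem corollary1 (r α p β : ℝ) (hr0 : 0 < r) (hr1 : r < 1) (hα : 0 < α) (hp : 1 ≤ p) :
    SameOrder
      (fun n => orthApproxClass (2 * n - 1) ∞ (classL (psiExp α r) β (ENNReal.ofReal p)))
      (fun n => orthApproxClass (2 * n) ∞ (classL (psiExp α r) β (ENNReal.ofReal p))) ∧
    SameOrder
      (fun n => orthApproxClass (2 * n) ∞ (classL (psiExp α r) β (ENNReal.ofReal p)))
      (fun n => ENNReal.ofReal (Real.exp (-α * (n : ℝ) ^ r) * (n : ℝ) ^ ((1 - r) / p))) := by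
  obtain ⟨C, hC, hupper⟩ := exists_orthApproxClass_le hα hr0 hr1 hp
  obtain ⟨c, hc, hlower⟩ := exists_le_orthApproxClass hα hr0 hr1 hp
  -- Both approximation numbers lie between c T and C T for the same T = ψ(n) n^((1-r)/p), so they
  -- compare with ratio C / c.
  have hchain {C c T : ℝ} {A D : ℝ≥0∞} (hC : 0 < C) (hc : 0 < c)
      (hA : A ≤ ENNReal.ofReal (C * T)) (hD : ENNReal.ofReal (c * T) ≤ D) :
      A ≤ ENNReal.ofReal (C / c) * D := by
    calc A ≤ ENNReal.ofReal (C * T) := hA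
      _ = ENNReal.ofReal (C / c) * ENNReal.ofReal (c * T) := by
        rw [← ENNReal.ofReal_mul (by positivity)]
        congr 1
        field_simp
      _ ≤ _ := by gcongr
  have hinv {C : ℝ} {A D : ℝ≥0∞} (hC : 0 < C) (h : A ≤ ENNReal.ofReal C * D) :
      ENNReal.ofReal C⁻¹ * A ≤ D := by
    calc ENNReal.ofReal C⁻¹ * A ≤ ENNReal.ofReal C⁻¹ * (ENNReal.ofReal C * D) := by gcongr
      _ = D := by
        rw [← mul_assoc, ← ENNReal.ofReal_mul (by positivity), inv_mul_cancel₀ hC.ne',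
          ENNReal.ofReal_one, one_mul]
  have hCc : 0 < C / c := div_pos hC hc
  refine ⟨⟨(C / c)⁻¹, C / c, by positivity, hCc, fun n hn => ⟨?_, ?_⟩⟩,
    ⟨C⁻¹, c⁻¹, by positivity, by positivity, fun n hn => ⟨?_, ?_⟩⟩⟩
  · exact hinv hCc (hchain hC hc (hupper β n hn _ (.inl rfl)) (hlower β n hn _ le_rfl))
  · exact hchain hC hc (hupper β n hn _ (.inr rfl)) (hlower β n hn _ (by omega))
  · refine hinv hC ((hupper β n hn _ (.inr rfl)).trans_eq ?_)
    rw [ENNReal.ofReal_mul hC.le]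
    rfl
  · have h := hlower β n hn _ le_rfl
    rw [ENNReal.ofReal_mul hc.le] at h
    refine le_trans (le_of_eq ?_) (mul_le_mul_right h (ENNReal.ofReal c⁻¹))
    rw [← mul_assoc, ← ENNReal.ofReal_mul (by positivity), inv_mul_cancel₀ hc.ne',
      ENNReal.ofReal_one, one_mul]
    rfl
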